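/- Let $d\ge 3$, and let $V$ be a real symmetric positive definite $d\times d$ matrix with $V_{aa}=1$ for all $a$; let $\lambda$ be its smallest eigenvalue. Let $\kappa>0$ and $\gamma\in(0,1]$, and let $h:\mathbb{R}^d\to\mathbb{R}$ be a $(\kappa,\gamma,V)$-Lipschitz function, i.e. a Borel function such that $$E\big((h(Y)-h(Y'))^2\big)\le \kappa^2\,\big(E\|Y-Y'\|^2\big)^{\gamma}$$ for every centered Gaussian vector $(Y,Y')$ in $\mathbb{R}^d\times\mathbb{R}^d$ with $\operatorname{cov}(Y)\le V$ and $\operatorname{cov}(Y')\le V$ (that is, $V-\operatorname{cov}(Y)$ and $V-\operatorname{cov}(Y')$ are positive semi-definite); here $\|\cdot\|$ is the Euclidean norm. Let $(i_n)_{n\ge0}$ be independent random variables uniformly distributed over $\{1,\dots,d\}$, and let $(g_n)_{n\ge0}$ be independent standard Gaussian random variables, the sequence $(g_n)$ being independent of the sequence $(i_n)$. Let $X_0=0$ and $$X_{n+1}=X_n+(g_n-e_{i_n}^TX_n)\,(Ve_{i_n}),\qquad n\ge0,$$ where $e_a$ is the $a$-th standard basis vector of $\mathbb{R}^d$. For $X\sim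 N(0,V)$ set $m=E(h(X))$, $\Sigma^2=\operatorname{var}(h(X))$ with $\Sigma\ge0$, and let $\kappa'=2\kappa d^{1+\gamma}/(\lambda\gamma)$. Then $h(X)$ is square-integrable. Moreover, for every even $n>0$, the estimator $\frac{2}{n}\sum_{j=n/2}^{n-1}h(X_j)$ is square-integrable and $$\Big|E\Big(\frac{\sum_{j=n/2}^{n-1}h(X_j)}{n/2}-m\Big)\Big|\le 2\kappa'\,\frac{e^{-\lambda\gamma n/(4d)}}{n}.$$ Furthermore, if $\Sigma>0$, $\delta=\lceil 4(\lambda\gamma)^{-1}d\ln(\kappa d/\Sigma)\rceil$ and $n>2\delta$, then $$E\Big(\Big(\frac{\sum_{j=n/2}^{n-1}h(X_j)}{n/2}-m\Big)^2\Big)\le 34\,\frac{\delta\,\Sigma^2}{n}.$$ -/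

import Mathlib

open MeasureTheory ProbabilityTheory
open scoped ENNReal

noncomputable section

/-- The covariance matrix `E (Y Yᵀ)` of a centered random vector `Y` in `ℝ^d`, defined on a
measure space `(Ω, μ)`. -/
def covMatrix {Ω : Type*} [MeasurableSpace Ω] {d : ℕ} (μ : Measure Ω)
    (Y : Ω → EuclideanSpace ℝ (Fin d)) : Matrix (Fin d) (Fin d) ℝ :=
  Matrix.of fun a b => ∫ ω, Y ω a * Y ω b ∂μ

/-- `(κ, γ, W)`-Lipschitz functions: Borel functions `h` on `ℝ^d` such that
`E (h(X) - h(X'))² ≤ κ² (E ‖X - X'‖²)^γ` for every centered Gaussian vector `(X, X')` with values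
in `ℝ^d × ℝ^d` such that `cov X ≤ W` and `cov X' ≤ W` in the Loewner order.
The Gaussian vector is represented by its law `ν`. The left-hand side is an integral with values
in `[0, ∞]`, so that the inequality includes its finiteness. -/
structure IsGaussianLipschitz {d : ℕ} (κ γ : ℝ) (W : Matrix (Fin d) (Fin d) ℝ)
    (h : EuclideanSpace ℝ (Fin d) → ℝ) : Prop where
  measurable : Measurable h
  bound : ∀ ν : Measure (EuclideanSpace ℝ (Fin d) × EuclideanSpace ℝ (Fin d)),
    IsGaussian ν → ∫ p, p ∂ν = 0 →
    (W - covMatrix ν Prod.fst).PosSemidef → (W - covMatrix ν Prod.snd).PosSemidef →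
    ∫⁻ p, ENNReal.ofReal ((h p.1 - h p.2) ^ 2) ∂ν ≤
      ENNReal.ofReal (κ ^ 2 * (∫ p, ‖p.1 - p.2‖ ^ 2 ∂ν) ^ γ)

/-- The mean `m = E h(X)`, where `X ∼ N(0, V)`. -/
def gaussianMean {d : ℕ} (V : Matrix (Fin d) (Fin d) ℝ) (h : EuclideanSpace ℝ (Fin d) → ℝ) : ℝ :=
  ∫ x, h x ∂(multivariateGaussian 0 V)

/-- The standard deviation `Σ` of `h(X)`, where `X ∼ N(0, V)`. -/
def gaussianStd {d : ℕ} (V : Matrix (Fin d) (Fin d) ℝ) (h : EuclideanSpace ℝ (Fin d) → ℝ) : ℝ :=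
  Real.sqrt (Var[h; multivariateGaussian 0 V])

/-- The chain `X_0 = 0`, `X_{n+1} = X_n + (g_n - e_{i_n}ᵀ X_n) (V e_{i_n})`, driven by a sequence
of indices `i` and a sequence of real numbers `g`. -/
def chain {d : ℕ} (V : Matrix (Fin d) (Fin d) ℝ) (i : ℕ → Fin d) (g : ℕ → ℝ) :
    ℕ → EuclideanSpace ℝ (Fin d)
  | 0 => 0
  | n + 1 => chain V i g n +
      (g n - chain V i g n (i n)) • WithLp.toLp 2 (V.mulVec (Pi.single (i n) 1))

/-- The estimator `(∑_{j = n/2}^{n-1} h(X_j)) / (n/2)`, for even `n > 0`. -/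
def burnInEstimator {d : ℕ} (V : Matrix (Fin d) (Fin d) ℝ) (h : EuclideanSpace ℝ (Fin d) → ℝ)
    (n : ℕ) (i : ℕ → Fin d) (g : ℕ → ℝ) : ℝ :=
  (∑ j ∈ Finset.Ico (n / 2) n, h (chain V i g j)) / ((n : ℝ) / 2)

/-- The random inputs of the chain: the `i_n` are independent and uniformly distributed over the
`d` indices, the `g_n` are independent standard Gaussian random variables, and the sequence
`(g_n)` is independent of the sequence `(i_n)`. -/
structure IsChainInput {Ω : Type*} [MeasurableSpace Ω] {d : ℕ} (P : Measure Ω)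
    (i : ℕ → Ω → Fin d) (g : ℕ → Ω → ℝ) : Prop where
  measurable_index : ∀ n, Measurable (i n)
  measurable_noise : ∀ n, Measurable (g n)
  law_index : ∀ n, P.map (i n) = uniformOn Set.univ
  law_noise : ∀ n, P.map (g n) = gaussianReal 0 1
  iIndepFun_index : iIndepFun i P
  iIndepFun_noise : iIndepFun g P
  indepFun : IndepFun (fun ω n => g n ω) (fun ω n => i n ω) P

end

/-!
Resampling the coordinate `a` of `y` replaces `y` by `stepMap V a y + t • V e_a`, where
`stepMap V a` is the orthogonal projection along `V e_a` for the inner product `⟨x, y⟩ = xᵀ V⁻¹ y`;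
it preserves `N(0, V)`. The chain is therefore compared with its stationary version, which starts
at `x ∼ N(0, V)` and uses the same indices and noise. For fixed indices the two chains form a
Gaussian vector and differ by the image of `x` under a product of projections. One step multiplies
the mean of `yᵀ V⁻¹ y` over the index by at most `1 - λ / d`, so that the Lipschitz condition and
Jensen's inequality bound the `L²` distance of the values of `h` at time `n` by `K rⁿ`, with
`K = κ d^γ` and `r = (1 - λ / d)^(γ / 2)`. This yields the bias. Since the chain started at `0` is
independent of `x`, it also shows that the covariances of the stationary chain at lag `m` are at
most `Σ · min (Σ, K rᵐ)`, and summing them yields the mean square error.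
-/

section LinearAlgebra

variable {d : ℕ} {V : Matrix (Fin d) (Fin d) ℝ} {lam : ℝ}

lemma posSemidef_sub_smul_one_of_isLeast_hasEigenvalue (hV : V.IsHermitian)
    (hlam : IsLeast {μ : ℝ | Module.End.HasEigenvalue (Matrix.toLin' V) μ} lam) :
    (V - lam • (1 : Matrix (Fin d) (Fin d) ℝ)).PosSemidef := by
  have hH : (V - lam • (1 : Matrix (Fin d) (Fin d) ℝ)).IsHermitian :=
    hV.sub (Matrix.isHermitian_one.smul (IsSelfAdjoint.all lam))
  rw [hH.posSemidef_iff_eigenvalues_nonneg]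
  intro k
  have hvec := hH.mulVec_eigenvectorBasis k
  rw [Matrix.sub_mulVec, Matrix.smul_mulVec, Matrix.one_mulVec, sub_eq_iff_eq_add,
    ← add_smul] at hvec
  have hne : (hH.eigenvectorBasis k).ofLp ≠ 0 := by
    simpa using hH.eigenvectorBasis.orthonormal.ne_zero k
  have hle : lam ≤ hH.eigenvalues k + lam := hlam.2 <|
    Module.End.hasEigenvalue_of_hasEigenvector
      ⟨Module.End.mem_eigenspace_iff.2 (by simpa using hvec), hne⟩
  simpa using hle

lemma pos_of_posDef_of_hasEigenvalue (hV : V.PosDef)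
    (hlam : Module.End.HasEigenvalue (Matrix.toLin' V) lam) : 0 < lam := by
  obtain ⟨x, hx⟩ := hlam.exists_hasEigenvector
  have hpos : 0 < x ⬝ᵥ V.mulVec x := by simpa using hV.dotProduct_mulVec_pos hx.2
  rw [show V.mulVec x = lam • x by simpa using hx.apply_eq_smul, dotProduct_smul,
    smul_eq_mul] at hpos
  exact pos_of_mul_pos_left hpos (by simpa using dotProduct_star_self_nonneg x)

lemma posDef_of_posSemidef_sub_smul_one (hlam0 : 0 < lam)
    (hlam : (V - lam • (1 : Matrix (Fin d) (Fin d) ℝ)).PosSemidef) : V.PosDef := by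
  simpa using Matrix.PosDef.posSemidef_add hlam (Matrix.PosDef.one.smul hlam0)

lemma dotProduct_mulVec_single_one (hV : V.PosSemidef) (u : Fin d → ℝ) (a : Fin d) :
    u ⬝ᵥ V.mulVec (Pi.single a 1) = V.mulVec u a := by
  have htrans : V.transpose = V := by
    simpa [Matrix.conjTranspose_eq_transpose_of_trivial] using hV.isHermitian.eq
  rw [Matrix.dotProduct_mulVec, ← Matrix.mulVec_transpose, htrans,
    dotProduct_single_one]

lemma dotProduct_mulVec_sub_single (hV : V.PosSemidef) {a : Fin d} (hVa : V a a = 1)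
    (u : Fin d → ℝ) :
    (u - V.mulVec u a • Pi.single a 1) ⬝ᵥ V.mulVec (u - V.mulVec u a • Pi.single a 1) =
      u ⬝ᵥ V.mulVec u - V.mulVec u a ^ 2 := by
  have hVaa : V.mulVec (Pi.single a 1) a = 1 := by simp [hVa]
  simp only [Matrix.mulVec_sub, Matrix.mulVec_smul, dotProduct_sub, sub_dotProduct,
    smul_dotProduct, dotProduct_smul, dotProduct_mulVec_single_one hV, single_one_dotProduct, hVaa,
    Pi.sub_apply, Pi.smul_apply, smul_eq_mul]
  ring

lemma mul_dotProduct_self_le (hlam : (V - lam • (1 : Matrix (Fin d) (Fin d) ℝ)).PosSemidef)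
    (x : Fin d → ℝ) : lam * (x ⬝ᵥ x) ≤ x ⬝ᵥ V.mulVec x := by
  have hx := hlam.dotProduct_mulVec_nonneg x
  simp only [star_trivial, Matrix.sub_mulVec, Matrix.smul_mulVec, Matrix.one_mulVec,
    dotProduct_sub, dotProduct_smul, smul_eq_mul] at hx
  linarith

lemma le_one_of_posSemidef_sub_smul_one
    (hlam : (V - lam • (1 : Matrix (Fin d) (Fin d) ℝ)).PosSemidef) {a : Fin d} (hVa : V a a = 1) :
    lam ≤ 1 := by
  simpa [hVa] using mul_dotProduct_self_le hlam (Pi.single a 1)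

/-- The quadratic form `yᵀ V⁻¹ y`, the Lyapunov function of the chain. -/
noncomputable def invForm (V : Matrix (Fin d) (Fin d) ℝ) (y : EuclideanSpace ℝ (Fin d)) : ℝ :=
  y.ofLp ⬝ᵥ V⁻¹.mulVec y.ofLp

lemma invForm_nonneg (hV : V.PosDef) (y : EuclideanSpace ℝ (Fin d)) : 0 ≤ invForm V y := by
  simpa [invForm] using hV.inv.posSemidef.dotProduct_mulVec_nonneg y.ofLp

lemma mul_invForm_le_sq_norm (hlam0 : 0 < lam)
    (hlam : (V - lam • (1 : Matrix (Fin d) (Fin d) ℝ)).PosSemidef)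
    (y : EuclideanSpace ℝ (Fin d)) : lam * invForm V y ≤ ‖y‖ ^ 2 := by
  have hdet := (posDef_of_posSemidef_sub_smul_one hlam0 hlam).det_pos.ne'.isUnit
  obtain ⟨w, rfl⟩ : ∃ w : EuclideanSpace ℝ (Fin d), y = WithLp.toLp 2 (V.mulVec w.ofLp) :=
    ⟨WithLp.toLp 2 (V⁻¹.mulVec y.ofLp), by
      simp [Matrix.mulVec_mulVec, Matrix.mul_nonsing_inv _ hdet]⟩
  set y : EuclideanSpace ℝ (Fin d) := WithLp.toLp 2 (V.mulVec w.ofLp) with hy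
  have hform : invForm V y = inner ℝ y w := by
    simp [invForm, hy, Matrix.mulVec_mulVec, Matrix.nonsing_inv_mul _ hdet,
      EuclideanSpace.inner_eq_star_dotProduct, dotProduct_comm]
  have hw : lam * ‖w‖ ^ 2 ≤ inner ℝ y w := by
    have hsq : ‖w‖ ^ 2 = w.ofLp ⬝ᵥ w.ofLp := by
      rw [EuclideanSpace.real_norm_sq_eq]; simp only [dotProduct, pow_two]
    simpa [hsq, hy, EuclideanSpace.inner_eq_star_dotProduct]
      using mul_dotProduct_self_le hlam w.ofLp
  have hnorm : lam * ‖w‖ ≤ ‖y‖ := by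
    rcases (norm_nonneg w).eq_or_lt with h | h
    · simp [← h]
    · nlinarith [real_inner_le_norm y w]
  rw [hform]
  nlinarith [real_inner_le_norm y w, norm_nonneg y]

/-- The linear part `y ↦ y - y_a V e_a` of the update of coordinate `a`. -/
noncomputable def stepMap (V : Matrix (Fin d) (Fin d) ℝ) (a : Fin d) :
    EuclideanSpace ℝ (Fin d) →L[ℝ] EuclideanSpace ℝ (Fin d) :=
  ContinuousLinearMap.id ℝ _ -
    (EuclideanSpace.proj a).smulRight (WithLp.toLp 2 (V.mulVec (Pi.single a 1)))

lemma stepMap_apply (a : Fin d) (y : EuclideanSpace ℝ (Fin d)) :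
    stepMap V a y = y - y a • WithLp.toLp 2 (V.mulVec (Pi.single a 1)) := rfl

lemma invForm_stepMap (hV : V.PosDef) {a : Fin d} (hVa : V a a = 1)
    (y : EuclideanSpace ℝ (Fin d)) : invForm V (stepMap V a y) = invForm V y - y a ^ 2 := by
  have hdet := hV.det_pos.ne'.isUnit
  have hinv : V⁻¹.mulVec (V.mulVec (Pi.single a 1)) = Pi.single a 1 := by
    rw [Matrix.mulVec_mulVec, Matrix.nonsing_inv_mul _ hdet, Matrix.one_mulVec]
  have hsymm : V.mulVec (Pi.single a 1) ⬝ᵥ V⁻¹.mulVec y.ofLp = y a := by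
    rw [dotProduct_comm, dotProduct_mulVec_single_one hV.posSemidef, Matrix.mulVec_mulVec,
      Matrix.mul_nonsing_inv _ hdet, Matrix.one_mulVec]
  have hdiag : V.mulVec (Pi.single a 1) a = 1 := by simp [hVa]
  simp only [invForm, stepMap_apply, WithLp.ofLp_sub, WithLp.ofLp_smul, Matrix.mulVec_sub,
    Matrix.mulVec_smul, dotProduct_sub, sub_dotProduct, smul_dotProduct, dotProduct_smul, hinv,
    hsymm, hdiag, smul_eq_mul, dotProduct_single_one, Pi.sub_apply, Pi.smul_apply]
  ring

lemma sq_apply_le_invForm (hV : V.PosDef) {a : Fin d} (hVa : V a a = 1)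
    (y : EuclideanSpace ℝ (Fin d)) : y a ^ 2 ≤ invForm V y := by
  rw [← sub_nonneg, ← invForm_stepMap hV hVa]
  exact invForm_nonneg hV _

lemma sq_norm_le_mul_invForm (hV : V.PosDef) (hVdiag : ∀ a, V a a = 1)
    (y : EuclideanSpace ℝ (Fin d)) : ‖y‖ ^ 2 ≤ d * invForm V y := by
  rw [EuclideanSpace.real_norm_sq_eq]
  exact (Finset.sum_le_card_nsmul _ _ _ fun a _ => sq_apply_le_invForm hV (hVdiag a) y).trans_eq
    (by simp)

lemma sum_invForm_stepMap_le (hlam0 : 0 < lam)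
    (hlam : (V - lam • (1 : Matrix (Fin d) (Fin d) ℝ)).PosSemidef) (hVdiag : ∀ a, V a a = 1)
    (y : EuclideanSpace ℝ (Fin d)) :
    ∑ a, invForm V (stepMap V a y) ≤ (d - lam) * invForm V y := by
  have hV := posDef_of_posSemidef_sub_smul_one hlam0 hlam
  simp only [invForm_stepMap hV (hVdiag _), Finset.sum_sub_distrib,
    ← EuclideanSpace.real_norm_sq_eq, Finset.sum_const, Finset.card_univ, Fintype.card_fin,
    nsmul_eq_mul]
  linarith [mul_invForm_le_sq_norm hlam0 hlam y]

end LinearAlgebra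

section Chain

variable {d : ℕ} (V : Matrix (Fin d) (Fin d) ℝ)

/-- One step of the chain: the coordinate `a` of `y` is resampled with noise `t`. -/
noncomputable def chainStep (a : Fin d) (t : ℝ) (y : EuclideanSpace ℝ (Fin d)) :
    EuclideanSpace ℝ (Fin d) :=
  y + (t - y a) • WithLp.toLp 2 (V.mulVec (Pi.single a 1))

/-- The chain started at `x` instead of `0`; its stationary version is started at an independent
`x ∼ N(0, V)`. -/
noncomputable def chainFrom (i : ℕ → Fin d) (g : ℕ → ℝ) (x : EuclideanSpace ℝ (Fin d)) :
    ℕ → EuclideanSpace ℝ (Fin d)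
  | 0 => x
  | n + 1 => chainStep V (i n) (g n) (chainFrom i g x n)

/-- The linear part `x ↦ stepMap V (i (n-1)) (⋯ (stepMap V (i 0) x))` of `n` steps of the chain. -/
noncomputable def transition (i : ℕ → Fin d) :
    ℕ → EuclideanSpace ℝ (Fin d) →L[ℝ] EuclideanSpace ℝ (Fin d)
  | 0 => ContinuousLinearMap.id ℝ _
  | n + 1 => stepMap V (i n) ∘L transition i n

lemma chainStep_eq (a : Fin d) (t : ℝ) (y : EuclideanSpace ℝ (Fin d)) :
    chainStep V a t y = stepMap V a y + t • WithLp.toLp 2 (V.mulVec (Pi.single a 1)) := by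
  rw [chainStep, stepMap_apply]
  module

lemma chainFrom_zero_right (i : ℕ → Fin d) (g : ℕ → ℝ) (n : ℕ) :
    chainFrom V i g 0 n = chain V i g n := by
  induction n with
  | zero => rfl
  | succ n ih => rw [chainFrom, ih, chainStep, chain]

lemma chainFrom_succ' (i : ℕ → Fin d) (g : ℕ → ℝ) (x : EuclideanSpace ℝ (Fin d)) (n : ℕ) :
    chainFrom V i g x (n + 1) =
      chainFrom V (fun k => i (k + 1)) (fun k => g (k + 1)) (chainStep V (i 0) (g 0) x) n := by
  induction n with
  | zero => rfl
  | succ n ih => rw [chainFrom, ih, chainFrom]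

lemma transition_succ' (i : ℕ → Fin d) (n : ℕ) :
    transition V i (n + 1) = transition V (fun k => i (k + 1)) n ∘L stepMap V (i 0) := by
  induction n with
  | zero => rfl
  | succ n ih => rw [transition, ih, transition, ContinuousLinearMap.comp_assoc]

lemma chainFrom_eq_transition_add_chain (i : ℕ → Fin d) (g : ℕ → ℝ)
    (x : EuclideanSpace ℝ (Fin d)) (n : ℕ) :
    chainFrom V i g x n = transition V i n x + chain V i g n := by
  induction n with
  | zero => simp [chainFrom, transition, chain]
  | succ n ih =>
    rw [← chainFrom_zero_right] at ih ⊢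
    simp only [chainFrom, ih, chainStep_eq, map_add, transition, ContinuousLinearMap.comp_apply,
      add_assoc]

lemma chain_succ' (i : ℕ → Fin d) (g : ℕ → ℝ) (n : ℕ) :
    chain V i g (n + 1) =
      transition V (fun k => i (k + 1)) n
        (g 0 • WithLp.toLp 2 (V.mulVec (Pi.single (i 0) 1))) +
      chain V (fun k => i (k + 1)) (fun k => g (k + 1)) n := by
  rw [← chainFrom_zero_right, chainFrom_succ', chainFrom_eq_transition_add_chain, chainStep_eq,
    map_zero, zero_add]

lemma measurable_chainStep :
    Measurable fun p : (Fin d × ℝ) × EuclideanSpace ℝ (Fin d) => chainStep V p.1.1 p.1.2 p.2 := by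
  suffices Measurable fun p : Fin d × ℝ × EuclideanSpace ℝ (Fin d) =>
      chainStep V p.1 p.2.1 p.2.2 from this.comp MeasurableEquiv.prodAssoc.measurable
  refine measurable_from_prod_countable_right fun a => ?_
  simp only [chainStep_eq]
  fun_prop

lemma measurable_chainFrom (n : ℕ) :
    Measurable fun p : ((ℕ → Fin d) × (ℕ → ℝ)) × EuclideanSpace ℝ (Fin d) =>
      chainFrom V p.1.1 p.1.2 p.2 n := by
  induction n with
  | zero => exact measurable_snd
  | succ n ih =>
    have hn : Measurable fun p : ((ℕ → Fin d) × (ℕ → ℝ)) × EuclideanSpace ℝ (Fin d) =>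
        (p.1.1 n, p.1.2 n) := by fun_prop
    exact (measurable_chainStep V).comp (hn.prodMk ih)

lemma measurable_chain (n : ℕ) :
    Measurable fun p : (ℕ → Fin d) × (ℕ → ℝ) => chain V p.1 p.2 n := by
  simp only [← chainFrom_zero_right]
  exact (measurable_chainFrom V n).comp (measurable_id.prodMk measurable_const)

end Chain

section Shift

variable {α : Type*} [MeasurableSpace α] (ν : Measure α) [IsProbabilityMeasure ν]

lemma map_prod_infinitePi_natCases :
    (ν.prod (Measure.infinitePi fun _ : ℕ => ν)).map
      (fun p n => Nat.casesOn (motive := fun _ => α) n p.1 p.2) =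
        Measure.infinitePi fun _ : ℕ => ν := by
  refine Measure.eq_infinitePi _ fun s t ht => ?_
  classical
  obtain ⟨n, hn⟩ := s.exists_nat_subset_range
  let t' (k : ℕ) : Set α := if k ∈ s then t k else Set.univ
  have ht' (k : ℕ) : MeasurableSet (t' k) := by
    unfold t'
    split_ifs
    exacts [ht k, .univ]
  have hpre : (fun (p : α × (ℕ → α)) n => Nat.casesOn (motive := fun _ => α) n p.1 p.2) ⁻¹'
      Set.pi s t = t' 0 ×ˢ Set.pi (Finset.range n) fun k => t' (k + 1) := by
    ext p
    simp only [Set.mem_preimage, Set.mem_pi, Finset.mem_coe, Set.mem_prod, Finset.mem_range, t']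
    constructor
    · refine fun hp => ⟨?_, fun k _ => ?_⟩
      · split_ifs with h0
        exacts [hp 0 h0, trivial]
      · split_ifs with hk
        exacts [hp (k + 1) hk, trivial]
    · rintro ⟨h0, hp⟩ (_ | k) hk
      · simpa [hk] using h0
      · simpa [hk] using hp k (by have := Finset.mem_range.1 (hn hk); omega)
  have hmeas : Measurable fun (p : α × (ℕ → α)) n =>
      Nat.casesOn (motive := fun _ => α) n p.1 p.2 := by
    refine measurable_pi_lambda _ ?_
    rintro (_ | k)
    · exact measurable_fst
    · exact (measurable_pi_apply k).comp measurable_snd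
  calc _ = ν (t' 0) * ∏ k ∈ Finset.range n, ν (t' (k + 1)) := by
        rw [Measure.map_apply hmeas (.pi s.countable_toSet fun k _ => ht k), hpre,
          Measure.prod_prod, Measure.infinitePi_pi _ fun k _ => ht' _]
    _ = ∏ k ∈ Finset.range (n + 1), ν (t' k) := by rw [Finset.prod_range_succ', mul_comm]
    _ = ∏ k ∈ s, ν (t k) := by
      rw [← Finset.prod_subset (hn.trans (Finset.range_mono n.le_succ)) fun k _ hk => by
        simp [t', hk]]
      exact Finset.prod_congr rfl fun k hk => by simp [t', hk]

lemma measurePreserving_infinitePi_head_tail :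
    MeasurePreserving (fun u : ℕ → α => (u 0, fun n => u (n + 1)))
      (Measure.infinitePi fun _ : ℕ => ν) (ν.prod (Measure.infinitePi fun _ : ℕ => ν)) where
  measurable := by fun_prop
  map_eq := by
    conv_lhs => rw [← map_prod_infinitePi_natCases]
    rw [Measure.map_map (by fun_prop)]
    · exact Measure.map_id
    · refine measurable_pi_lambda _ ?_
      rintro (_ | k)
      · exact measurable_fst
      · exact (measurable_pi_apply k).comp measurable_snd

lemma measurePreserving_infinitePi_tail :
    MeasurePreserving (fun (u : ℕ → α) n => u (n + 1))
      (Measure.infinitePi fun _ : ℕ => ν) (Measure.infinitePi fun _ : ℕ => ν) :=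
  measurePreserving_snd.comp (measurePreserving_infinitePi_head_tail ν)

end Shift

section Stationarity

variable {d : ℕ} {V : Matrix (Fin d) (Fin d) ℝ}

lemma inner_chainStep (hV : V.PosSemidef) (a : Fin d) (t : ℝ) (y u : EuclideanSpace ℝ (Fin d)) :
    inner ℝ (chainStep V a t y) u =
      inner ℝ y (u - V.mulVec u.ofLp a • EuclideanSpace.single a 1) +
        inner ℝ t (V.mulVec u.ofLp a) := by
  have hcol : inner ℝ (WithLp.toLp 2 (V.mulVec (Pi.single a 1))) u = V.mulVec u.ofLp a := by
    rw [EuclideanSpace.inner_eq_star_dotProduct, star_trivial, dotProduct_mulVec_single_one hV]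
  simp only [chainStep, inner_add_left, inner_sub_right, real_inner_smul_left,
    real_inner_smul_right, hcol, EuclideanSpace.inner_single_right, conj_trivial, one_mul,
    RCLike.inner_apply]
  ring

lemma measurePreserving_chainStep (hV : V.PosSemidef) {a : Fin d} (hVa : V a a = 1) :
    MeasurePreserving (fun p : EuclideanSpace ℝ (Fin d) × ℝ => chainStep V a p.2 p.1)
      ((multivariateGaussian 0 V).prod (gaussianReal 0 1)) (multivariateGaussian 0 V) := by
  have hmeas : Measurable fun p : EuclideanSpace ℝ (Fin d) × ℝ => chainStep V a p.2 p.1 := by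
    simp only [chainStep_eq]
    fun_prop
  refine ⟨hmeas, Measure.ext_of_charFun (funext fun u => ?_)⟩
  set c : ℝ := V.mulVec u.ofLp a
  rw [charFun_apply, integral_map hmeas.aemeasurable (by fun_prop)]
  simp only [inner_chainStep hV, Complex.ofReal_add, add_mul, Complex.exp_add]
  rw [integral_prod_mul
    (fun y => Complex.exp ((inner ℝ y (u - c • EuclideanSpace.single a 1) : ℝ) * Complex.I))
    (fun t : ℝ => Complex.exp ((inner ℝ t c : ℝ) * Complex.I)), ← charFun_apply, ← charFun_apply,
    charFun_multivariateGaussian hV, charFun_multivariateGaussian hV, charFun_gaussianReal,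
    WithLp.ofLp_sub, WithLp.ofLp_smul, PiLp.ofLp_single, dotProduct_mulVec_sub_single hV hVa,
    ← Complex.exp_add]
  congr 1
  simp only [inner_zero_right, Complex.ofReal_zero, zero_mul, mul_zero, NNReal.coe_one,
    Complex.ofReal_one, one_mul, Complex.ofReal_sub, Complex.ofReal_pow]
  ring

/-- The law of the noise, a sequence of independent standard Gaussian variables. -/
noncomputable def noiseLaw : Measure (ℕ → ℝ) := Measure.infinitePi fun _ => gaussianReal 0 1

/-- The law of the updated coordinates, independent and uniform on the `d` indices. -/
noncomputable def indexLaw (d : ℕ) : Measure (ℕ → Fin d) :=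
  Measure.infinitePi fun _ => uniformOn Set.univ

instance : IsProbabilityMeasure noiseLaw := by unfold noiseLaw; infer_instance

instance [NeZero d] : IsProbabilityMeasure (uniformOn (Set.univ : Set (Fin d))) :=
  isProbabilityMeasure_uniformOn Set.finite_univ Set.univ_nonempty

instance [NeZero d] : IsProbabilityMeasure (indexLaw d) := by unfold indexLaw; infer_instance

lemma measurePreserving_chainStep_tail (hV : V.PosSemidef) {a : Fin d} (hVa : V a a = 1) :
    MeasurePreserving
      (fun p : EuclideanSpace ℝ (Fin d) × (ℕ → ℝ) =>
        (chainStep V a (p.2 0) p.1, fun n => p.2 (n + 1)))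
      ((multivariateGaussian 0 V).prod noiseLaw) ((multivariateGaussian 0 V).prod noiseLaw) :=
  ((measurePreserving_chainStep hV hVa).prod (.id _)).comp <|
    (measurePreserving_prodAssoc _ _ _).symm.comp <|
      (MeasurePreserving.id _).prod (measurePreserving_infinitePi_head_tail _)

lemma measurePreserving_chainFrom (hV : V.PosSemidef) (hVdiag : ∀ a, V a a = 1) (i : ℕ → Fin d)
    (n : ℕ) :
    MeasurePreserving (fun p : EuclideanSpace ℝ (Fin d) × (ℕ → ℝ) => chainFrom V i p.2 p.1 n)
      ((multivariateGaussian 0 V).prod noiseLaw) (multivariateGaussian 0 V) := by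
  induction n generalizing i with
  | zero => exact measurePreserving_fst
  | succ n ih =>
    simp only [chainFrom_succ']
    exact (ih _).comp (measurePreserving_chainStep_tail hV (hVdiag (i 0)))

/-- The joint law of the indices, the stationary initial state and the noise. -/
noncomputable def stationaryLaw (V : Matrix (Fin d) (Fin d) ℝ) :
    Measure ((ℕ → Fin d) × EuclideanSpace ℝ (Fin d) × (ℕ → ℝ)) :=
  (indexLaw d).prod ((multivariateGaussian 0 V).prod noiseLaw)

instance [NeZero d] : IsProbabilityMeasure (stationaryLaw V) := by
  unfold stationaryLaw; infer_instance

/-- One step of the stationary chain, which discards the consumed index and noise. The chain is a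
function of the orbit of this measure-preserving map. -/
noncomputable def shift (V : Matrix (Fin d) (Fin d) ℝ)
    (z : (ℕ → Fin d) × EuclideanSpace ℝ (Fin d) × (ℕ → ℝ)) :
    (ℕ → Fin d) × EuclideanSpace ℝ (Fin d) × (ℕ → ℝ) :=
  (fun n => z.1 (n + 1), chainStep V (z.1 0) (z.2.2 0) z.2.1, fun n => z.2.2 (n + 1))

lemma measurePreserving_shift [NeZero d] (hV : V.PosSemidef) (hVdiag : ∀ a, V a a = 1) :
    MeasurePreserving (shift V) (stationaryLaw V) (stationaryLaw V) := by
  refine (measurePreserving_infinitePi_tail _).skew_product ?_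
    (.of_forall fun i => (measurePreserving_chainStep_tail hV (hVdiag (i 0))).map_eq)
  exact ((measurable_chainStep V).comp (f := fun z : (ℕ → Fin d) ×
    EuclideanSpace ℝ (Fin d) × (ℕ → ℝ) => ((z.1 0, z.2.2 0), z.2.1)) (by fun_prop)).prodMk
      (by fun_prop)

/-- The stationary version of the chain, which starts at the second component. -/
noncomputable def stationaryChain (V : Matrix (Fin d) (Fin d) ℝ) (n : ℕ)
    (z : (ℕ → Fin d) × EuclideanSpace ℝ (Fin d) × (ℕ → ℝ)) : EuclideanSpace ℝ (Fin d) :=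
  chainFrom V z.1 z.2.2 z.2.1 n

lemma stationaryChain_succ (n : ℕ) (z : (ℕ → Fin d) × EuclideanSpace ℝ (Fin d) × (ℕ → ℝ)) :
    stationaryChain V (n + 1) z = stationaryChain V n (shift V z) :=
  chainFrom_succ' V z.1 z.2.2 z.2.1 n

lemma measurable_stationaryChain (n : ℕ) : Measurable (stationaryChain V n) :=
  (measurable_chainFrom V n).comp (f := fun z : (ℕ → Fin d) ×
    EuclideanSpace ℝ (Fin d) × (ℕ → ℝ) => ((z.1, z.2.2), z.2.1)) (by fun_prop)

lemma measurePreserving_stationaryChain [NeZero d] (hV : V.PosSemidef) (hVdiag : ∀ a, V a a = 1)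
    (n : ℕ) :
    MeasurePreserving (stationaryChain V n) (stationaryLaw V) (multivariateGaussian 0 V) := by
  induction n with
  | zero => exact measurePreserving_fst.comp measurePreserving_snd
  | succ n ih =>
    rw [funext (stationaryChain_succ n)]
    exact ih.comp (measurePreserving_shift hV hVdiag)

lemma integral_mul_stationaryChain_add [NeZero d] (hV : V.PosSemidef) (hVdiag : ∀ a, V a a = 1)
    {f : EuclideanSpace ℝ (Fin d) → ℝ} (hf : Measurable f) (j m : ℕ) :
    ∫ z, f (stationaryChain V j z) * f (stationaryChain V (j + m) z) ∂(stationaryLaw V) =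
      ∫ z, f z.2.1 * f (stationaryChain V m z) ∂(stationaryLaw V) := by
  induction j with
  | zero => simp only [zero_add]; rfl
  | succ j ih =>
    have hmeas (k : ℕ) : Measurable fun z => f (stationaryChain V k z) :=
      hf.comp (measurable_stationaryChain k)
    have hshift := measurePreserving_shift hV hVdiag
    have hmap := integral_map (μ := stationaryLaw V) hshift.measurable.aemeasurable
      ((hmeas j).mul (hmeas (j + m))).aestronglyMeasurable
    rw [hshift.map_eq] at hmap
    simp only [← ih, Nat.succ_add, stationaryChain_succ]
    exact hmap.symm

end Stationarity

section Covariance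

variable {d : ℕ} {V : Matrix (Fin d) (Fin d) ℝ}

lemma covMatrix_map {Ω Ω' : Type*} [MeasurableSpace Ω] [MeasurableSpace Ω'] {μ : Measure Ω}
    {f : Ω → Ω'} (hf : Measurable f) {Y : Ω' → EuclideanSpace ℝ (Fin d)} (hY : Measurable Y) :
    covMatrix (μ.map f) Y = covMatrix μ (Y ∘ f) := by
  ext a b
  exact integral_map hf.aemeasurable (by fun_prop)

lemma posSemidef_covMatrix {Ω : Type*} [MeasurableSpace Ω] {μ : Measure Ω}
    {Y : Ω → EuclideanSpace ℝ (Fin d)} (hY : ∀ a, MemLp (fun ω => Y ω a) 2 μ) :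
    (covMatrix μ Y).PosSemidef := by
  refine Matrix.PosSemidef.of_dotProduct_mulVec_nonneg ?_ fun t => ?_
  · ext a b
    simp [covMatrix, mul_comm]
  have hint (a b : Fin d) : Integrable (fun ω => t a * (Y ω a * Y ω b * t b)) μ :=
    (((hY a).integrable_mul (hY b)).mul_const _).const_mul _
  have hform : star t ⬝ᵥ (covMatrix μ Y).mulVec t = ∫ ω, (∑ a, t a * Y ω a) ^ 2 ∂μ := by
    have hexp (ω : Ω) : (∑ a, t a * Y ω a) ^ 2 = ∑ a, ∑ b, t a * (Y ω a * Y ω b * t b) := by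
      rw [pow_two, Finset.sum_mul_sum]
      exact Finset.sum_congr rfl fun a _ => Finset.sum_congr rfl fun b _ => by ring
    simp only [hexp, integral_finsetSum _ fun a _ => integrable_finsetSum _ fun b _ => hint a b,
      integral_finsetSum _ fun b _ => hint _ b, integral_const_mul, integral_mul_const,
      star_trivial, dotProduct, Matrix.mulVec, Finset.mul_sum, covMatrix, Matrix.of_apply]
  exact hform ▸ integral_nonneg fun ω => sq_nonneg _

lemma memLp_apply_of_isGaussian (ν : Measure (EuclideanSpace ℝ (Fin d))) [IsGaussian ν]
    (a : Fin d) : MemLp (fun y : EuclideanSpace ℝ (Fin d) => y a) 2 ν :=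
  IsGaussian.memLp_dual ν (EuclideanSpace.proj a) 2 (by simp)

lemma integral_apply_of_isGaussian {ν : Measure (EuclideanSpace ℝ (Fin d))} [IsGaussian ν]
    (hν : ∫ y, y ∂ν = 0) (a : Fin d) : ∫ y : EuclideanSpace ℝ (Fin d), y a ∂ν = 0 := by
  simpa [hν] using IsGaussian.integral_dual (μ := ν) (EuclideanSpace.proj a)

lemma covMatrix_multivariateGaussian (hV : V.PosSemidef) :
    covMatrix (multivariateGaussian 0 V) id = V := by
  ext a b
  have hmean := integral_apply_of_isGaussian
    (integral_id_multivariateGaussian (μ := (0 : EuclideanSpace ℝ (Fin d))) (S := V))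
  simpa [covariance_eval_multivariateGaussian hV, hmean, covMatrix] using
    (covariance_eq_sub (memLp_apply_of_isGaussian (multivariateGaussian 0 V) a)
      (memLp_apply_of_isGaussian (multivariateGaussian 0 V) b)).symm

lemma covMatrix_prod_add (ρ ν : Measure (EuclideanSpace ℝ (Fin d))) [IsGaussian ρ] [IsGaussian ν]
    (hν : ∫ z, z ∂ν = 0) :
    covMatrix (ρ.prod ν) (fun p => p.1 + p.2) = covMatrix ρ id + covMatrix ν id := by
  ext a b
  have hρ2 (c : Fin d) := memLp_apply_of_isGaussian ρ c
  have hν2 (c : Fin d) := memLp_apply_of_isGaussian ν c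
  have hfst : Integrable (fun p => p.1 a * p.1 b) (ρ.prod ν) :=
    Integrable.comp_fst ((hρ2 a).integrable_mul (hρ2 b)) ν
  have hsnd : Integrable (fun p => p.2 a * p.2 b) (ρ.prod ν) :=
    Integrable.comp_snd ((hν2 a).integrable_mul (hν2 b)) ρ
  have hmul (c e : Fin d) : Integrable (fun p => p.1 c * p.2 e) (ρ.prod ν) :=
    ((hρ2 c).integrable (by simp)).mul_prod ((hν2 e).integrable (by simp))
  have hcross (c e : Fin d) : ∫ p, p.1 c * p.2 e ∂(ρ.prod ν) = 0 := by
    rw [integral_prod_mul (fun y : EuclideanSpace ℝ (Fin d) => y c)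
      (fun z : EuclideanSpace ℝ (Fin d) => z e), integral_apply_of_isGaussian hν, mul_zero]
  calc ∫ p, (p.1 a + p.2 a) * (p.1 b + p.2 b) ∂(ρ.prod ν)
      = ∫ p, (p.1 a * p.1 b + p.2 a * p.2 b) + (p.1 a * p.2 b + p.1 b * p.2 a) ∂(ρ.prod ν) := by
        congr 1 with p
        ring
    _ = ∫ p, p.1 a * p.1 b ∂(ρ.prod ν) + ∫ p, p.2 a * p.2 b ∂(ρ.prod ν) := by
        rw [integral_add (by exact hfst.add hsnd) (by exact (hmul a b).add (hmul b a)),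
          integral_add hfst hsnd, integral_add (hmul a b) (hmul b a), hcross, hcross]
        simp only [add_zero]
    _ = ∫ y, y a * y b ∂ρ + ∫ z, z a * z b ∂ν := by
        rw [integral_fun_fst (fun y : EuclideanSpace ℝ (Fin d) => y a * y b),
          integral_fun_snd (fun z : EuclideanSpace ℝ (Fin d) => z a * z b)]
        simp only [probReal_univ, one_smul]

/- The coupling is `(u + z, z)` with `u ∼ ρ` and `z ∼ ν` independent. -/
lemma IsGaussianLipschitz.lintegral_add_sub_le {κ γ : ℝ} {h : EuclideanSpace ℝ (Fin d) → ℝ}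
    (hh : IsGaussianLipschitz κ γ V h) (ρ ν : Measure (EuclideanSpace ℝ (Fin d))) [IsGaussian ρ]
    [IsGaussian ν] (hρ : ∫ u, u ∂ρ = 0) (hν : ∫ z, z ∂ν = 0)
    (hcov : (V - (covMatrix ρ id + covMatrix ν id)).PosSemidef) :
    ∫⁻ p, ENNReal.ofReal ((h (p.1 + p.2) - h p.2) ^ 2) ∂(ρ.prod ν) ≤
      ENNReal.ofReal (κ ^ 2 * (∫ u, ‖u‖ ^ 2 ∂ρ) ^ γ) := by
  let L := (ContinuousLinearMap.fst ℝ (EuclideanSpace ℝ (Fin d)) (EuclideanSpace ℝ (Fin d)) +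
    ContinuousLinearMap.snd ℝ _ _).prod (ContinuousLinearMap.snd ℝ _ _)
  have hL : Measurable L := L.continuous.measurable
  have hmean : ∫ p, p ∂((ρ.prod ν).map L) = 0 := by
    rw [integral_map hL.aemeasurable (by fun_prop),
      integral_continuousLinearMap_prod IsGaussian.integrable_id IsGaussian.integrable_id,
      (L.comp _).integral_comp_comm IsGaussian.integrable_fun_id,
      (L.comp _).integral_comp_comm IsGaussian.integrable_fun_id, hρ, hν, map_zero, map_zero,
      add_zero]
  have hcov1 : covMatrix ((ρ.prod ν).map L) Prod.fst = covMatrix ρ id + covMatrix ν id := by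
    rw [covMatrix_map hL measurable_fst, ← covMatrix_prod_add ρ ν hν]
    rfl
  have hcov2 : covMatrix ((ρ.prod ν).map L) Prod.snd = covMatrix ν id := by
    rw [covMatrix_map hL measurable_snd, ← (measurePreserving_snd (μ := ρ) (ν := ν)).map_eq,
      covMatrix_map measurable_snd measurable_id, measurePreserving_snd.map_eq]
    rfl
  have hbound := hh.bound ((ρ.prod ν).map L) inferInstance hmean (by rwa [hcov1]) (by
    have hρcov := posSemidef_covMatrix (Y := id) (memLp_apply_of_isGaussian ρ)
    rw [hcov2]
    convert hcov.add hρcov using 1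
    abel)
  have hm := hh.measurable
  rw [lintegral_map (by fun_prop) hL, integral_map hL.aemeasurable (by fun_prop)] at hbound
  refine hbound.trans_eq ?_
  simp only [L, ContinuousLinearMap.prod_apply, add_apply,
    ContinuousLinearMap.coe_fst', ContinuousLinearMap.coe_snd', add_sub_cancel_right]
  rw [integral_fun_fst (fun u : EuclideanSpace ℝ (Fin d) => ‖u‖ ^ 2), probReal_univ, one_smul]

end Covariance

section Coupling

variable {d : ℕ} {V : Matrix (Fin d) (Fin d) ℝ} {κ γ : ℝ} {h : EuclideanSpace ℝ (Fin d) → ℝ}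

lemma measurable_chain_noise (i : ℕ → Fin d) (n : ℕ) : Measurable fun g => chain V i g n :=
  (measurable_chain V n).comp measurable_prodMk_left

lemma map_chain_succ (i : ℕ → Fin d) (n : ℕ) :
    noiseLaw.map (fun g => chain V i g (n + 1)) =
      ((gaussianReal 0 1).prod (noiseLaw.map fun g => chain V (fun k => i (k + 1)) g n)).map
        ((transition V (fun k => i (k + 1)) n ∘L (ContinuousLinearMap.id ℝ ℝ).smulRight
            (WithLp.toLp 2 (V.mulVec (Pi.single (i 0) 1)))).coprod
          (ContinuousLinearMap.id ℝ _)) := by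
  have hchain := measurable_chain_noise (V := V) (fun k => i (k + 1)) n
  have hprod := Measure.map_prod_map (gaussianReal 0 1) noiseLaw measurable_id hchain
  rw [Measure.map_id] at hprod
  rw [hprod, Measure.map_map (by fun_prop) (measurable_id.prodMap hchain), noiseLaw,
    ← (measurePreserving_infinitePi_head_tail (gaussianReal 0 1)).map_eq,
    Measure.map_map (by fun_prop) (by fun_prop)]
  exact congrArg (Measure.map · _) (funext fun g => chain_succ' V i g n)

lemma isGaussian_map_chain (i : ℕ → Fin d) (n : ℕ) :
    IsGaussian (noiseLaw.map fun g => chain V i g n) := by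
  induction n generalizing i with
  | zero =>
    simp only [chain, Measure.map_const, measure_univ, one_smul]
    infer_instance
  | succ n ih =>
    have := ih fun k => i (k + 1)
    rw [map_chain_succ]
    infer_instance

lemma integral_map_chain (i : ℕ → Fin d) (n : ℕ) :
    ∫ z, z ∂(noiseLaw.map fun g => chain V i g n) = 0 := by
  induction n generalizing i with
  | zero => simp [chain]
  | succ n ih =>
    have := isGaussian_map_chain (V := V) (fun k => i (k + 1)) n
    rw [map_chain_succ, integral_map (by fun_prop) (by fun_prop),
      integral_continuousLinearMap_prod IsGaussian.integrable_id IsGaussian.integrable_id,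
      ContinuousLinearMap.integral_comp_comm _ IsGaussian.integrable_fun_id,
      ContinuousLinearMap.integral_comp_comm _ IsGaussian.integrable_fun_id, ih, map_zero,
      add_zero, integral_id_gaussianReal, map_zero]

lemma map_transition_prod_map_chain (hV : V.PosSemidef) (hVdiag : ∀ a, V a a = 1)
    (i : ℕ → Fin d) (n : ℕ) :
    (((multivariateGaussian 0 V).map (transition V i n)).prod
      (noiseLaw.map fun g => chain V i g n)).map (fun p => p.1 + p.2) =
        multivariateGaussian 0 V := by
  have hT : Measurable (transition V i n) := (transition V i n).continuous.measurable
  have hchain := measurable_chain_noise (V := V) i n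
  refine Eq.trans ?_ (measurePreserving_chainFrom hV hVdiag i n).map_eq
  rw [Measure.map_prod_map _ _ hT hchain, Measure.map_map (by fun_prop) (hT.prodMap hchain)]
  exact congrArg (Measure.map · _) (funext fun p : _ × (ℕ → ℝ) =>
    (chainFrom_eq_transition_add_chain V i p.2 p.1 n).symm)

lemma lintegral_sq_chainFrom_sub_chain_le (hh : IsGaussianLipschitz κ γ V h) (hV : V.PosSemidef)
    (hVdiag : ∀ a, V a a = 1) (i : ℕ → Fin d) (n : ℕ) :
    ∫⁻ p, ENNReal.ofReal ((h (chainFrom V i p.2 p.1 n) - h (chain V i p.2 n)) ^ 2)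
        ∂((multivariateGaussian 0 V).prod noiseLaw) ≤
      ENNReal.ofReal (κ ^ 2 * (∫ x, ‖transition V i n x‖ ^ 2 ∂(multivariateGaussian 0 V)) ^ γ) := by
  set N := multivariateGaussian 0 V
  have hT : Measurable (transition V i n) := (transition V i n).continuous.measurable
  have hchain := measurable_chain_noise (V := V) i n
  have := isGaussian_map_chain (V := V) i n
  have hmean : ∫ u, u ∂(N.map (transition V i n)) = 0 := by
    rw [(transition V i n).integral_id_map IsGaussian.integrable_id,
      integral_id_multivariateGaussian, map_zero]
  have hcov : covMatrix (N.map (transition V i n)) id +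
      covMatrix (noiseLaw.map fun g => chain V i g n) id = V := by
    rw [← covMatrix_prod_add _ _ (integral_map_chain i n)]
    refine (covMatrix_map (by fun_prop) measurable_id).symm.trans ?_
    rw [map_transition_prod_map_chain hV hVdiag, covMatrix_multivariateGaussian hV]
  have hbound := hh.lintegral_add_sub_le (N.map (transition V i n))
    (noiseLaw.map fun g => chain V i g n) hmean (integral_map_chain i n)
    (by rw [hcov, sub_self]; exact .zero)
  have hm := hh.measurable
  rw [Measure.map_prod_map _ _ hT hchain, lintegral_map (by fun_prop) (hT.prodMap hchain),
    integral_map hT.aemeasurable (by fun_prop)] at hbound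
  simpa only [chainFrom_eq_transition_add_chain, Prod.map_fst, Prod.map_snd] using hbound

end Coupling

section Contraction

variable {d : ℕ} {V : Matrix (Fin d) (Fin d) ℝ} {lam κ γ : ℝ} {h : EuclideanSpace ℝ (Fin d) → ℝ}

lemma lintegral_uniformOn_univ (f : Fin d → ℝ≥0∞) :
    ∫⁻ a, f a ∂(uniformOn Set.univ) = (d : ℝ≥0∞)⁻¹ * ∑ a, f a := by
  rw [uniformOn, ProbabilityTheory.cond, lintegral_smul_measure, Measure.restrict_univ,
    lintegral_count, tsum_fintype]
  simp

lemma lintegral_rpow_le {Ω : Type*} [MeasurableSpace Ω] {P : Measure Ω} [IsProbabilityMeasure P]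
    {F : Ω → ℝ≥0∞} (hF : AEMeasurable F P) (hγ0 : 0 < γ) (hγ1 : γ ≤ 1) :
    ∫⁻ ω, F ω ^ γ ∂P ≤ (∫⁻ ω, F ω ∂P) ^ γ := by
  have := eLpNorm'_le_eLpNorm'_of_exponent_le hγ0 hγ1 P hF.aestronglyMeasurable
  simp only [eLpNorm', enorm_eq_self, ENNReal.rpow_one, div_one] at this
  calc ∫⁻ ω, F ω ^ γ ∂P = ((∫⁻ ω, F ω ^ γ ∂P) ^ (1 / γ)) ^ γ := by
        rw [← ENNReal.rpow_mul, one_div_mul_cancel hγ0.ne', ENNReal.rpow_one]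
    _ ≤ _ := ENNReal.rpow_le_rpow this hγ0.le

lemma measurable_transition (n : ℕ) :
    Measurable fun p : (ℕ → Fin d) × EuclideanSpace ℝ (Fin d) => transition V p.1 n p.2 := by
  have heq (p : (ℕ → Fin d) × EuclideanSpace ℝ (Fin d)) :
      transition V p.1 n p.2 = chainFrom V p.1 0 p.2 n - chain V p.1 0 n := by
    rw [chainFrom_eq_transition_add_chain, add_sub_cancel_right]
  simp only [heq]
  exact ((measurable_chainFrom V n).comp (f := fun p : (ℕ → Fin d) × EuclideanSpace ℝ (Fin d) =>
    ((p.1, 0), p.2)) (by fun_prop)).sub ((measurable_chain V n).comp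
      (measurable_fst.prodMk measurable_const))

lemma measurable_invForm : Measurable (invForm V) := by
  unfold invForm
  simp only [dotProduct, Matrix.mulVec]
  fun_prop

lemma one_sub_div_nonneg [NeZero d]
    (hlam : (V - lam • (1 : Matrix (Fin d) (Fin d) ℝ)).PosSemidef) (hVdiag : ∀ a, V a a = 1) :
    0 ≤ 1 - lam / d := by
  have hd : (1 : ℝ) ≤ d := by exact_mod_cast NeZero.one_le
  have hlam1 := le_one_of_posSemidef_sub_smul_one hlam (hVdiag 0)
  rw [sub_nonneg, div_le_one (by positivity)]
  exact hlam1.trans hd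

lemma lintegral_invForm_stepMap_le [NeZero d] (hlam0 : 0 < lam)
    (hlam : (V - lam • (1 : Matrix (Fin d) (Fin d) ℝ)).PosSemidef) (hVdiag : ∀ a, V a a = 1)
    (y : EuclideanSpace ℝ (Fin d)) :
    ∫⁻ a, ENNReal.ofReal (invForm V (stepMap V a y)) ∂(uniformOn Set.univ) ≤
      ENNReal.ofReal ((1 - lam / d) * invForm V y) := by
  have hd : (0 : ℝ) < d := by exact_mod_cast NeZero.pos d
  have hV := posDef_of_posSemidef_sub_smul_one hlam0 hlam
  rw [lintegral_uniformOn_univ, ← ENNReal.ofReal_sum_of_nonneg fun a _ => invForm_nonneg hV _,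
    ← ENNReal.ofReal_natCast, ← ENNReal.ofReal_inv_of_pos hd, ← ENNReal.ofReal_mul (by positivity)]
  refine ENNReal.ofReal_le_ofReal ?_
  rw [inv_mul_le_iff₀ hd]
  refine (sum_invForm_stepMap_le hlam0 hlam hVdiag y).trans_eq ?_
  field_simp

lemma lintegral_invForm_transition_le [NeZero d] (hlam0 : 0 < lam)
    (hlam : (V - lam • (1 : Matrix (Fin d) (Fin d) ℝ)).PosSemidef) (hVdiag : ∀ a, V a a = 1)
    (n : ℕ) (y : EuclideanSpace ℝ (Fin d)) :
    ∫⁻ i, ENNReal.ofReal (invForm V (transition V i n y)) ∂(indexLaw d) ≤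
      ENNReal.ofReal ((1 - lam / d) ^ n * invForm V y) := by
  have hs := one_sub_div_nonneg hlam hVdiag
  induction n generalizing y with
  | zero => simp [transition]
  | succ n ih =>
    have hF : Measurable fun p : Fin d × (ℕ → Fin d) =>
        ENNReal.ofReal (invForm V (transition V p.2 n (stepMap V p.1 y))) :=
      (measurable_invForm.comp ((measurable_transition n).comp
        (measurable_snd.prodMk ((measurable_of_countable fun a => stepMap V a y).comp
          measurable_fst)))).ennreal_ofReal
    calc ∫⁻ i, ENNReal.ofReal (invForm V (transition V i (n + 1) y)) ∂(indexLaw d)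
        = ∫⁻ a, ∫⁻ i, ENNReal.ofReal (invForm V (transition V i n (stepMap V a y)))
            ∂(indexLaw d) ∂(uniformOn Set.univ) := by
          simp only [transition_succ', ContinuousLinearMap.comp_apply]
          exact ((measurePreserving_infinitePi_head_tail _).lintegral_comp hF).trans
            (lintegral_prod _ hF.aemeasurable)
      _ ≤ ∫⁻ a, ENNReal.ofReal ((1 - lam / d) ^ n) *
            ENNReal.ofReal (invForm V (stepMap V a y)) ∂(uniformOn Set.univ) := by
          refine lintegral_mono fun a => (ih _).trans_eq (ENNReal.ofReal_mul (by positivity))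
      _ ≤ ENNReal.ofReal ((1 - lam / d) ^ n) * ENNReal.ofReal ((1 - lam / d) * invForm V y) := by
          rw [lintegral_const_mul' _ _ ENNReal.ofReal_ne_top]
          gcongr
          exact lintegral_invForm_stepMap_le hlam0 hlam hVdiag y
      _ = ENNReal.ofReal ((1 - lam / d) ^ (n + 1) * invForm V y) := by
          rw [← ENNReal.ofReal_mul (by positivity), pow_succ, mul_assoc]

lemma lintegral_invForm_multivariateGaussian (hV : V.PosDef) :
    ∫⁻ y, ENNReal.ofReal (invForm V y) ∂(multivariateGaussian 0 V) = d := by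
  have hterm (y : EuclideanSpace ℝ (Fin d)) :
      invForm V y = ∑ a, ∑ b, V⁻¹ a b * (y a * y b) := by
    simp only [invForm, dotProduct, Matrix.mulVec, Finset.mul_sum]
    exact Finset.sum_congr rfl fun a _ => Finset.sum_congr rfl fun b _ => by ring
  have hint (a b : Fin d) : Integrable (fun y : EuclideanSpace ℝ (Fin d) => V⁻¹ a b * (y a * y b))
      (multivariateGaussian 0 V) :=
    ((memLp_apply_of_isGaussian _ a).integrable_mul (memLp_apply_of_isGaussian _ b)).const_mul _
  have hint' : Integrable (invForm V) (multivariateGaussian 0 V) := by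
    rw [funext hterm]
    exact integrable_finsetSum _ fun a _ => integrable_finsetSum _ fun b _ => hint a b
  have hcov (a b : Fin d) :
      ∫ y : EuclideanSpace ℝ (Fin d), y a * y b ∂(multivariateGaussian 0 V) = V b a :=
    (congrFun₂ (covMatrix_multivariateGaussian hV.posSemidef) a b).trans
      (hV.isHermitian.apply b a)
  have htrace : (V⁻¹ * V).trace = d := by
    rw [Matrix.nonsing_inv_mul _ ((Matrix.isUnit_iff_isUnit_det _).1 hV.isUnit),
      Matrix.trace_one, Fintype.card_fin]
  rw [← ofReal_integral_eq_lintegral_ofReal hint' (.of_forall fun y => invForm_nonneg hV y),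
    ← ENNReal.ofReal_natCast, ← htrace]
  simp only [hterm, integral_finsetSum _ fun a _ => integrable_finsetSum _ fun b _ => hint a b,
    integral_finsetSum _ fun b _ => hint _ b, integral_const_mul, hcov, Matrix.trace,
    Matrix.diag_apply, Matrix.mul_apply]

lemma lintegral_sq_norm_transition_le [NeZero d] (hlam0 : 0 < lam)
    (hlam : (V - lam • (1 : Matrix (Fin d) (Fin d) ℝ)).PosSemidef) (hVdiag : ∀ a, V a a = 1)
    (n : ℕ) :
    ∫⁻ i, ∫⁻ y, ENNReal.ofReal (‖transition V i n y‖ ^ 2) ∂(multivariateGaussian 0 V)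
        ∂(indexLaw d) ≤ ENNReal.ofReal (d ^ 2 * (1 - lam / d) ^ n) := by
  have hV := posDef_of_posSemidef_sub_smul_one hlam0 hlam
  have hs := one_sub_div_nonneg hlam hVdiag
  have hmeas := ((measurable_transition (V := V) n).norm.pow_const 2).ennreal_ofReal
  rw [lintegral_lintegral_swap hmeas.aemeasurable]
  calc ∫⁻ y, ∫⁻ i, ENNReal.ofReal (‖transition V i n y‖ ^ 2) ∂(indexLaw d)
        ∂(multivariateGaussian 0 V)
      ≤ ∫⁻ y, ∫⁻ i, d * ENNReal.ofReal (invForm V (transition V i n y)) ∂(indexLaw d)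
        ∂(multivariateGaussian 0 V) := by
        refine lintegral_mono fun y => lintegral_mono fun i => ?_
        rw [← ENNReal.ofReal_natCast, ← ENNReal.ofReal_mul (by positivity)]
        exact ENNReal.ofReal_le_ofReal (sq_norm_le_mul_invForm hV hVdiag _)
    _ ≤ ∫⁻ y, d * ENNReal.ofReal ((1 - lam / d) ^ n) * ENNReal.ofReal (invForm V y)
        ∂(multivariateGaussian 0 V) := by
        refine lintegral_mono fun y => ?_
        rw [lintegral_const_mul' _ _ (ENNReal.natCast_ne_top d), mul_assoc,
          ← ENNReal.ofReal_mul (by positivity)]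
        gcongr
        exact lintegral_invForm_transition_le hlam0 hlam hVdiag n y
    _ = ENNReal.ofReal (d ^ 2 * (1 - lam / d) ^ n) := by
        rw [lintegral_const_mul _ measurable_invForm.ennreal_ofReal,
          lintegral_invForm_multivariateGaussian hV, ENNReal.ofReal_mul (by positivity),
          pow_two, ENNReal.ofReal_mul (Nat.cast_nonneg d), ENNReal.ofReal_natCast]
        ring

lemma lintegral_rpow_sq_norm_transition_le [NeZero d] (hlam0 : 0 < lam)
    (hlam : (V - lam • (1 : Matrix (Fin d) (Fin d) ℝ)).PosSemidef) (hVdiag : ∀ a, V a a = 1)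
    (hγ0 : 0 < γ) (hγ1 : γ ≤ 1) (n : ℕ) :
    ∫⁻ i, ENNReal.ofReal ((∫ y, ‖transition V i n y‖ ^ 2 ∂(multivariateGaussian 0 V)) ^ γ)
        ∂(indexLaw d) ≤ ENNReal.ofReal ((d ^ 2 * (1 - lam / d) ^ n) ^ γ) := by
  have hs := one_sub_div_nonneg hlam hVdiag
  have hmeas := ((measurable_transition (V := V) n).norm.pow_const 2).ennreal_ofReal
  have hint (i : ℕ → Fin d) :
      Integrable (fun y => ‖transition V i n y‖ ^ 2) (multivariateGaussian 0 V) :=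
    ((transition V i n).comp_memLp' IsGaussian.memLp_two_id).integrable_norm_pow two_ne_zero
  calc ∫⁻ i, ENNReal.ofReal ((∫ y, ‖transition V i n y‖ ^ 2 ∂(multivariateGaussian 0 V)) ^ γ)
        ∂(indexLaw d)
      = ∫⁻ i, (∫⁻ y, ENNReal.ofReal (‖transition V i n y‖ ^ 2) ∂(multivariateGaussian 0 V)) ^ γ
        ∂(indexLaw d) := by
        refine lintegral_congr fun i => ?_
        rw [← ofReal_integral_eq_lintegral_ofReal (hint i) (.of_forall fun y => by positivity),
          ENNReal.ofReal_rpow_of_nonneg (integral_nonneg fun y => by positivity) hγ0.le]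
    _ ≤ (∫⁻ i, ∫⁻ y, ENNReal.ofReal (‖transition V i n y‖ ^ 2) ∂(multivariateGaussian 0 V)
        ∂(indexLaw d)) ^ γ :=
        lintegral_rpow_le hmeas.lintegral_prod_right'.aemeasurable hγ0 hγ1
    _ ≤ ENNReal.ofReal ((d ^ 2 * (1 - lam / d) ^ n) ^ γ) := by
        rw [← ENNReal.ofReal_rpow_of_nonneg (by positivity) hγ0.le]
        gcongr
        exact lintegral_sq_norm_transition_le hlam0 hlam hVdiag n

lemma lintegral_sq_stationaryChain_sub_chain_le [NeZero d] (hh : IsGaussianLipschitz κ γ V h)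
    (hlam0 : 0 < lam) (hlam : (V - lam • (1 : Matrix (Fin d) (Fin d) ℝ)).PosSemidef)
    (hVdiag : ∀ a, V a a = 1) (hγ0 : 0 < γ) (hγ1 : γ ≤ 1) (n : ℕ) :
    ∫⁻ z, ENNReal.ofReal ((h (stationaryChain V n z) - h (chain V z.1 z.2.2 n)) ^ 2)
        ∂(stationaryLaw V) ≤
      ENNReal.ofReal (κ ^ 2 * (d ^ 2 * (1 - lam / d) ^ n) ^ γ) := by
  have hV := (posDef_of_posSemidef_sub_smul_one hlam0 hlam).posSemidef
  have hmeas : Measurable fun z : (ℕ → Fin d) × EuclideanSpace ℝ (Fin d) × (ℕ → ℝ) =>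
      ENNReal.ofReal ((h (stationaryChain V n z) - h (chain V z.1 z.2.2 n)) ^ 2) :=
    (((hh.measurable.comp (measurable_stationaryChain n)).sub
      (hh.measurable.comp ((measurable_chain V n).comp
        (measurable_fst.prodMk measurable_snd.snd)))).pow_const 2).ennreal_ofReal
  calc _ = ∫⁻ i, ∫⁻ p, ENNReal.ofReal ((h (chainFrom V i p.2 p.1 n) - h (chain V i p.2 n)) ^ 2)
          ∂((multivariateGaussian 0 V).prod noiseLaw) ∂(indexLaw d) :=
        lintegral_prod _ hmeas.aemeasurable
    _ ≤ ∫⁻ i, ENNReal.ofReal (κ ^ 2) * ENNReal.ofReal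
          ((∫ y, ‖transition V i n y‖ ^ 2 ∂(multivariateGaussian 0 V)) ^ γ) ∂(indexLaw d) := by
        simp only [← ENNReal.ofReal_mul (sq_nonneg κ)]
        exact lintegral_mono fun i => lintegral_sq_chainFrom_sub_chain_le hh hV hVdiag i n
    _ ≤ ENNReal.ofReal (κ ^ 2 * (d ^ 2 * (1 - lam / d) ^ n) ^ γ) := by
        rw [lintegral_const_mul' _ _ ENNReal.ofReal_ne_top, ENNReal.ofReal_mul (sq_nonneg κ)]
        gcongr
        exact lintegral_rpow_sq_norm_transition_le hlam0 hlam hVdiag hγ0 hγ1 n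

end Contraction

section Geometric

variable {E : Type*} {K r S : ℝ}

lemma norm_sum_Ico_le_of_norm_le_geometric [SeminormedAddCommGroup E] {C : ℕ → E} (hK : 0 ≤ K)
    (hr0 : 0 ≤ r) (hr1 : r < 1) (hC : ∀ j, ‖C j‖ ≤ K * r ^ j) (k n : ℕ) :
    ‖∑ j ∈ Finset.Ico k n, C j‖ ≤ K * r ^ k / (1 - r) := by
  refine (norm_sum_le_of_le _ fun j _ => hC j).trans ?_
  rw [← Finset.mul_sum, mul_div_assoc]
  gcongr
  exact geom_sum_Ico_le_of_lt_one hr0 hr1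

variable [NormedAddCommGroup E] [InnerProductSpace ℝ E] {A B : ℕ → E}

lemma sq_norm_sum_range_le {c : ℕ → ℝ} {C : ℝ} (hB : ∀ j m, |inner ℝ (B j) (B (j + m))| ≤ c m)
    (hc : ∀ n, ∑ m ∈ Finset.range n, c m ≤ C) (k : ℕ) :
    ‖∑ j ∈ Finset.range k, B j‖ ^ 2 ≤ 2 * k * C := by
  induction k with
  | zero => simp
  | succ k ih =>
    have hcross : inner ℝ (∑ j ∈ Finset.range k, B j) (B k) ≤ ∑ m ∈ Finset.range k, c (m + 1) := by
      rw [sum_inner, ← Finset.sum_range_reflect (fun m => c (m + 1))]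
      refine Finset.sum_le_sum fun j hj => ?_
      have hjk := Finset.mem_range.1 hj
      have hle := (le_abs_self _).trans (hB j (k - j))
      rwa [Nat.add_sub_cancel' hjk.le, show k - j = k - 1 - j + 1 by omega] at hle
    have hdiag : ‖B k‖ ^ 2 ≤ c 0 := by
      rw [← real_inner_self_eq_norm_sq]
      exact (le_abs_self _).trans (hB k 0)
    have hsum := hc (k + 1)
    rw [Finset.sum_range_succ'] at hsum
    rw [Finset.sum_range_succ, norm_add_sq_real]
    push_cast
    linarith [sq_nonneg ‖B k‖]

lemma sum_range_min_geometric_le (hK : 0 ≤ K) (hS : 0 ≤ S) (hr0 : 0 ≤ r) (hr1 : r < 1)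
    (δ n : ℕ) : ∑ m ∈ Finset.range n, min (S * S) (S * (K * r ^ m)) ≤
      δ * S ^ 2 + S * (K * r ^ δ / (1 - r)) := by
  calc ∑ m ∈ Finset.range n, min (S * S) (S * (K * r ^ m))
      ≤ ∑ m ∈ Finset.range (n + δ), min (S * S) (S * (K * r ^ m)) :=
        Finset.sum_le_sum_of_subset_of_nonneg (Finset.range_mono (Nat.le_add_right n δ))
          fun _ _ _ => le_min (by positivity) (by positivity)
    _ ≤ ∑ _ ∈ Finset.range δ, S * S + ∑ m ∈ Finset.Ico δ (n + δ), S * (K * r ^ m) := by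
        rw [← Finset.sum_range_add_sum_Ico _ (Nat.le_add_left δ n)]
        gcongr
        exacts [min_le_left _ _, min_le_right _ _]
    _ ≤ δ * S ^ 2 + S * (K * r ^ δ / (1 - r)) := by
        rw [Finset.sum_const, Finset.card_range, nsmul_eq_mul, ← pow_two, ← Finset.mul_sum,
          ← Finset.mul_sum, mul_div_assoc]
        gcongr
        exact geom_sum_Ico_le_of_lt_one hr0 hr1

lemma sq_norm_sum_Ico_le_of_abs_inner_le_geometric (hK : 0 ≤ K) (hS : 0 ≤ S) (hr0 : 0 ≤ r)
    (hr1 : r < 1) (hAB : ∀ j, ‖A j - B j‖ ≤ K * r ^ j) (hB : ∀ j, ‖B j‖ ≤ S)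
    (hBB : ∀ j m, |inner ℝ (B j) (B (j + m))| ≤ S * (K * r ^ m)) {δ k : ℕ} (hδk : δ ≤ k) :
    ‖∑ j ∈ Finset.Ico k (2 * k), A j‖ ^ 2 ≤ 2 * ((K * r ^ δ / (1 - r)) ^ 2 +
      2 * k * (δ * S ^ 2 + S * (K * r ^ δ / (1 - r)))) := by
  have hdiff : ‖∑ j ∈ Finset.Ico k (2 * k), (A j - B j)‖ ≤ K * r ^ δ / (1 - r) := by
    refine (norm_sum_Ico_le_of_norm_le_geometric hK hr0 hr1 hAB k (2 * k)).trans ?_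
    gcongr ?_ / _
    exact mul_le_mul_of_nonneg_left (pow_le_pow_of_le_one hr0 hr1.le hδk) hK
  have hmain : ‖∑ j ∈ Finset.Ico k (2 * k), B j‖ ^ 2 ≤
      2 * k * (δ * S ^ 2 + S * (K * r ^ δ / (1 - r))) := by
    rw [Finset.sum_Ico_eq_sum_range, show 2 * k - k = k by omega]
    refine sq_norm_sum_range_le (fun j m => le_min ?_ ?_)
      (sum_range_min_geometric_le hK hS hr0 hr1 δ) k
    · exact (abs_real_inner_le_norm _ _).trans (mul_le_mul (hB _) (hB _) (norm_nonneg _) hS)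
    · simpa only [add_assoc] using hBB (k + j) m
  calc ‖∑ j ∈ Finset.Ico k (2 * k), A j‖ ^ 2
      = ‖∑ j ∈ Finset.Ico k (2 * k), (A j - B j) + ∑ j ∈ Finset.Ico k (2 * k), B j‖ ^ 2 := by
        rw [← Finset.sum_add_distrib]
        simp only [sub_add_cancel]
    _ ≤ 2 * (‖∑ j ∈ Finset.Ico k (2 * k), (A j - B j)‖ ^ 2 +
          ‖∑ j ∈ Finset.Ico k (2 * k), B j‖ ^ 2) :=
        (pow_le_pow_left₀ (norm_nonneg _) (norm_add_le _ _) 2).trans add_sq_le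
    _ ≤ _ := by gcongr

end Geometric

section SecondMoments

variable {Ω : Type*} [MeasurableSpace Ω] {μ : Measure Ω} {K r S : ℝ}

lemma eLpNorm_two_le_of_lintegral_sq_le {f : Ω → ℝ} {c : ℝ} (hc : 0 ≤ c)
    (hf : ∫⁻ ω, ENNReal.ofReal (f ω ^ 2) ∂μ ≤ ENNReal.ofReal (c ^ 2)) :
    eLpNorm f 2 μ ≤ ENNReal.ofReal c := by
  have hsq (ω : Ω) : ‖f ω‖ₑ ^ (2 : ℝ) = ENNReal.ofReal (f ω ^ 2) := by
    rw [← ofReal_norm, ENNReal.rpow_two, ← ENNReal.ofReal_pow (norm_nonneg _), Real.norm_eq_abs,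
      sq_abs]
  rw [eLpNorm_eq_lintegral_rpow_enorm_toReal two_ne_zero ENNReal.ofNat_ne_top,
    ENNReal.toReal_ofNat]
  simp only [hsq, one_div]
  rw [ENNReal.rpow_inv_le_iff two_pos, ENNReal.rpow_two, ← ENNReal.ofReal_pow hc]
  exact hf

lemma inner_toLp {f g : Ω → ℝ} (hf : MemLp f 2 μ) (hg : MemLp g 2 μ) :
    inner ℝ (hf.toLp f) (hg.toLp g) = ∫ ω, f ω * g ω ∂μ := by
  rw [L2.inner_def]
  refine integral_congr_ae ?_
  filter_upwards [hf.coeFn_toLp, hg.coeFn_toLp] with ω hfω hgω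
  rw [hfω, hgω]
  exact mul_comm _ _

lemma toLp_sum {A : ℕ → Ω → ℝ} (hA : ∀ j, MemLp (A j) 2 μ) (s : Finset ℕ) :
    (memLp_finsetSum s fun j _ => hA j).toLp (fun ω => ∑ j ∈ s, A j ω) =
      ∑ j ∈ s, (hA j).toLp (A j) := by
  induction s using Finset.cons_induction with
  | empty => exact MemLp.toLp_zero _
  | cons a s ha ih =>
    rw [Finset.sum_cons, ← ih, ← MemLp.toLp_add]
    exact MemLp.toLp_congr _ _ (.of_forall fun ω => Finset.sum_cons ha)

lemma norm_toLp_sub_le {f g : Ω → ℝ} (hf : MemLp f 2 μ) (hg : MemLp g 2 μ) {c : ℝ} (hc : 0 ≤ c)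
    (hfg : eLpNorm (fun ω => f ω - g ω) 2 μ ≤ ENNReal.ofReal c) : ‖hf.toLp f - hg.toLp g‖ ≤ c := by
  rw [← MemLp.toLp_sub, Lp.norm_toLp]
  exact ENNReal.toReal_le_of_le_ofReal hc hfg

lemma abs_integral_sum_Ico_le_of_eLpNorm_sub_le [IsProbabilityMeasure μ] {A B : ℕ → Ω → ℝ}
    (hA : ∀ j, MemLp (A j) 2 μ) (hB : ∀ j, MemLp (B j) 2 μ) (hK : 0 ≤ K) (hr0 : 0 ≤ r)
    (hr1 : r < 1)
    (hAB : ∀ j, eLpNorm (fun ω => A j ω - B j ω) 2 μ ≤ ENNReal.ofReal (K * r ^ j))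
    (hB0 : ∀ j, ∫ ω, B j ω ∂μ = 0) (k n : ℕ) :
    |∫ ω, ∑ j ∈ Finset.Ico k n, A j ω ∂μ| ≤ K * r ^ k / (1 - r) := by
  have hone : MemLp (fun _ : Ω => (1 : ℝ)) 2 μ := memLp_const 1
  have hone_norm : ‖hone.toLp‖ = 1 := by
    rw [Lp.norm_toLp, eLpNorm_const _ two_ne_zero (NeZero.ne μ)]
    simp
  have hmean (j : ℕ) : inner ℝ (hone.toLp) ((hB j).toLp (B j)) = 0 := by
    simp only [inner_toLp, one_mul, hB0]
  calc |∫ ω, ∑ j ∈ Finset.Ico k n, A j ω ∂μ|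
      = |inner ℝ hone.toLp (∑ j ∈ Finset.Ico k n, ((hA j).toLp (A j) - (hB j).toLp (B j)))| := by
        simp only [Finset.sum_sub_distrib, inner_sub_right, inner_sum, hmean]
        rw [Finset.sum_const_zero, sub_zero, ← inner_sum, ← toLp_sum, inner_toLp]
        simp only [one_mul]
    _ ≤ K * r ^ k / (1 - r) := by
        refine (abs_real_inner_le_norm _ _).trans ?_
        rw [hone_norm, one_mul]
        exact norm_sum_Ico_le_of_norm_le_geometric hK hr0 hr1 (fun j =>
          norm_toLp_sub_le (hA j) (hB j) (by positivity) (hAB j)) k n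

lemma integral_sq_sum_Ico_le_of_eLpNorm_sub_le {A B : ℕ → Ω → ℝ} (hA : ∀ j, MemLp (A j) 2 μ)
    (hB : ∀ j, MemLp (B j) 2 μ) (hK : 0 ≤ K) (hS : 0 ≤ S) (hr0 : 0 ≤ r) (hr1 : r < 1)
    (hAB : ∀ j, eLpNorm (fun ω => A j ω - B j ω) 2 μ ≤ ENNReal.ofReal (K * r ^ j))
    (hBS : ∀ j, ∫ ω, B j ω ^ 2 ∂μ ≤ S ^ 2)
    (hBB : ∀ j m, |∫ ω, B j ω * B (j + m) ω ∂μ| ≤ S * (K * r ^ m)) {δ k : ℕ} (hδk : δ ≤ k) :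
    ∫ ω, (∑ j ∈ Finset.Ico k (2 * k), A j ω) ^ 2 ∂μ ≤ 2 * ((K * r ^ δ / (1 - r)) ^ 2 +
      2 * k * (δ * S ^ 2 + S * (K * r ^ δ / (1 - r)))) := by
  have hsum : ∫ ω, (∑ j ∈ Finset.Ico k (2 * k), A j ω) ^ 2 ∂μ =
      ‖∑ j ∈ Finset.Ico k (2 * k), (hA j).toLp (A j)‖ ^ 2 := by
    rw [← toLp_sum, ← real_inner_self_eq_norm_sq, inner_toLp]
    simp only [pow_two]
  rw [hsum]
  refine sq_norm_sum_Ico_le_of_abs_inner_le_geometric (B := fun j => (hB j).toLp (B j)) hK hS hr0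
    hr1 (fun j => norm_toLp_sub_le (hA j) (hB j) (by positivity) (hAB j)) (fun j => ?_)
    (fun j m => ?_) hδk
  · refine le_of_sq_le_sq ?_ hS
    rw [← real_inner_self_eq_norm_sq, inner_toLp]
    simpa only [← pow_two] using hBS j
  · simpa only [inner_toLp] using hBB j m

end SecondMoments

section LipschitzMoments

variable {d : ℕ} {V : Matrix (Fin d) (Fin d) ℝ} {κ γ : ℝ} {h : EuclideanSpace ℝ (Fin d) → ℝ}

lemma integral_sq_norm_multivariateGaussian (hV : V.PosSemidef) :
    ∫ x, ‖x‖ ^ 2 ∂(multivariateGaussian 0 V) = V.trace := by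
  have hcov (a : Fin d) :
      ∫ x : EuclideanSpace ℝ (Fin d), x a * x a ∂(multivariateGaussian 0 V) = V a a :=
    congrFun₂ (covMatrix_multivariateGaussian hV) a a
  have hint (a : Fin d) : Integrable (fun x : EuclideanSpace ℝ (Fin d) => x a * x a)
      (multivariateGaussian 0 V) :=
    (memLp_apply_of_isGaussian _ a).integrable_mul (memLp_apply_of_isGaussian _ a)
  calc ∫ x, ‖x‖ ^ 2 ∂(multivariateGaussian 0 V)
      = ∫ x : EuclideanSpace ℝ (Fin d), ∑ a, x a * x a ∂(multivariateGaussian 0 V) := by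
        simp only [EuclideanSpace.real_norm_sq_eq, ← pow_two]
    _ = V.trace := by
        rw [integral_finsetSum _ fun a _ => hint a]
        exact Finset.sum_congr rfl fun a _ => hcov a

lemma IsGaussianLipschitz.lintegral_sq_sub_zero_le (hh : IsGaussianLipschitz κ γ V h)
    (hV : V.PosSemidef) (hVdiag : ∀ a, V a a = 1) :
    ∫⁻ x, ENNReal.ofReal ((h x - h 0) ^ 2) ∂(multivariateGaussian 0 V) ≤
      ENNReal.ofReal (κ ^ 2 * (d : ℝ) ^ γ) := by
  have hcov : covMatrix (multivariateGaussian 0 V) id + covMatrix (.dirac 0) id = V := by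
    rw [covMatrix_multivariateGaussian hV, add_eq_left]
    ext a b
    simp [covMatrix]
  have hbound := hh.lintegral_add_sub_le (multivariateGaussian 0 V) (.dirac 0)
    integral_id_multivariateGaussian (integral_dirac _ _) (by rw [hcov, sub_self]; exact .zero)
  have hm := hh.measurable
  have htrace : V.trace = d := by simp [Matrix.trace, hVdiag]
  rw [integral_sq_norm_multivariateGaussian hV, htrace, Measure.prod_dirac,
    lintegral_map (by fun_prop) (by fun_prop)] at hbound
  simpa only [add_zero] using hbound

lemma IsGaussianLipschitz.memLp (hh : IsGaussianLipschitz κ γ V h) (hV : V.PosSemidef)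
    (hVdiag : ∀ a, V a a = 1) : MemLp h 2 (multivariateGaussian 0 V) := by
  have hsub : MemLp (fun x => h x - h 0) 2 (multivariateGaussian 0 V) := by
    refine ⟨(hh.measurable.sub_const _).aestronglyMeasurable, (eLpNorm_two_le_of_lintegral_sq_le
      (Real.sqrt_nonneg (κ ^ 2 * (d : ℝ) ^ γ)) ?_).trans_lt ENNReal.ofReal_lt_top⟩
    rw [Real.sq_sqrt (by positivity)]
    exact hh.lintegral_sq_sub_zero_le hV hVdiag
  simpa only [Pi.add_def, sub_add_cancel] using hsub.add (memLp_const (h 0))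

lemma IsGaussianLipschitz.integral_sub_gaussianMean (hh : IsGaussianLipschitz κ γ V h)
    (hV : V.PosSemidef) (hVdiag : ∀ a, V a a = 1) :
    ∫ x, (h x - gaussianMean V h) ∂(multivariateGaussian 0 V) = 0 := by
  rw [integral_sub ((hh.memLp hV hVdiag).integrable one_le_two) (integrable_const _),
    integral_const, probReal_univ, one_smul, gaussianMean, sub_self]

lemma gaussianStd_nonneg : 0 ≤ gaussianStd V h := Real.sqrt_nonneg _

lemma IsGaussianLipschitz.gaussianStd_sq_le (hh : IsGaussianLipschitz κ γ V h)
    (hV : V.PosSemidef) (hVdiag : ∀ a, V a a = 1) :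
    gaussianStd V h ^ 2 ≤ κ ^ 2 * (d : ℝ) ^ γ := by
  have hm := hh.measurable
  rw [gaussianStd, Real.sq_sqrt (variance_nonneg _ _),
    ← variance_sub_const hm.aestronglyMeasurable (h 0)]
  refine (variance_le_expectation_sq (by fun_prop)).trans ?_
  simp only [Pi.pow_apply]
  rw [integral_eq_lintegral_of_nonneg_ae (.of_forall fun x => sq_nonneg _) (by fun_prop)]
  exact ENNReal.toReal_le_of_le_ofReal (by positivity) (hh.lintegral_sq_sub_zero_le hV hVdiag)

end LipschitzMoments

section StationaryCovariances

variable {d : ℕ} [NeZero d] {V : Matrix (Fin d) (Fin d) ℝ} {lam κ γ : ℝ}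
  {h : EuclideanSpace ℝ (Fin d) → ℝ}

lemma integral_comp_stationaryChain (hV : V.PosSemidef) (hVdiag : ∀ a, V a a = 1)
    {f : EuclideanSpace ℝ (Fin d) → ℝ} (hf : Measurable f) (n : ℕ) :
    ∫ z, f (stationaryChain V n z) ∂(stationaryLaw V) = ∫ x, f x ∂(multivariateGaussian 0 V) := by
  have hX := measurePreserving_stationaryChain hV hVdiag n
  rw [← integral_map hX.measurable.aemeasurable hf.aestronglyMeasurable, hX.map_eq]

lemma eLpNorm_chain_sub_stationaryChain_le (hh : IsGaussianLipschitz κ γ V h) (hκ : 0 ≤ κ)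
    (hlam0 : 0 < lam) (hlam : (V - lam • (1 : Matrix (Fin d) (Fin d) ℝ)).PosSemidef)
    (hVdiag : ∀ a, V a a = 1) (hγ0 : 0 < γ) (hγ1 : γ ≤ 1) (n : ℕ) :
    eLpNorm (fun z => h (chain V z.1 z.2.2 n) - h (stationaryChain V n z)) 2 (stationaryLaw V) ≤
      ENNReal.ofReal (κ * d ^ γ * ((1 - lam / d) ^ (γ / 2)) ^ n) := by
  have hs : 0 ≤ 1 - lam / d := one_sub_div_nonneg hlam hVdiag
  have hsq : κ ^ 2 * ((d : ℝ) ^ 2 * (1 - lam / d) ^ n) ^ γ =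
      (κ * d ^ γ * ((1 - lam / d) ^ (γ / 2)) ^ n) ^ 2 := by
    rw [Real.mul_rpow (by positivity) (by positivity), mul_pow, mul_pow, mul_assoc,
      ← pow_mul, mul_comm n 2, pow_mul, ← Real.rpow_mul_natCast hs, Nat.cast_ofNat,
      div_mul_cancel₀ γ two_ne_zero, Real.rpow_pow_comm (by positivity), Real.rpow_pow_comm hs]
  refine eLpNorm_two_le_of_lintegral_sq_le (by positivity) ?_
  rw [← hsq]
  simp only [sub_sq_comm (h (chain V _ _ n))]
  exact lintegral_sq_stationaryChain_sub_chain_le hh hlam0 hlam hVdiag hγ0 hγ1 n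

lemma memLp_stationaryChain (hh : IsGaussianLipschitz κ γ V h) (hV : V.PosSemidef)
    (hVdiag : ∀ a, V a a = 1) (n : ℕ) :
    MemLp (fun z => h (stationaryChain V n z)) 2 (stationaryLaw V) :=
  (hh.memLp hV hVdiag).comp_measurePreserving (measurePreserving_stationaryChain hV hVdiag n)

lemma memLp_chain (hh : IsGaussianLipschitz κ γ V h) (hκ : 0 ≤ κ)
    (hlam0 : 0 < lam) (hlam : (V - lam • (1 : Matrix (Fin d) (Fin d) ℝ)).PosSemidef)
    (hVdiag : ∀ a, V a a = 1) (hγ0 : 0 < γ) (hγ1 : γ ≤ 1) (n : ℕ) :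
    MemLp (fun z => h (chain V z.1 z.2.2 n)) 2 (stationaryLaw V) := by
  have hX := memLp_stationaryChain hh (posDef_of_posSemidef_sub_smul_one hlam0 hlam).posSemidef
    hVdiag n
  have hsub : MemLp (fun z => h (chain V z.1 z.2.2 n) - h (stationaryChain V n z)) 2
      (stationaryLaw V) :=
    ⟨(hh.measurable.comp ((measurable_chain V n).comp
        (measurable_fst.prodMk measurable_snd.snd))).aestronglyMeasurable.sub hX.1,
      (eLpNorm_chain_sub_stationaryChain_le hh hκ hlam0 hlam hVdiag hγ0 hγ1 n).trans_lt
        ENNReal.ofReal_lt_top⟩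
  simpa only [Pi.add_def, sub_add_cancel] using hsub.add hX

lemma integral_stationaryChain_sub_mean (hh : IsGaussianLipschitz κ γ V h) (hV : V.PosSemidef)
    (hVdiag : ∀ a, V a a = 1) (n : ℕ) :
    ∫ z, (h (stationaryChain V n z) - gaussianMean V h) ∂(stationaryLaw V) = 0 := by
  rw [integral_comp_stationaryChain hV hVdiag (hh.measurable.sub_const _),
    hh.integral_sub_gaussianMean hV hVdiag]

lemma integral_sq_stationaryChain_sub_mean (hh : Measurable h) (hV : V.PosSemidef)
    (hVdiag : ∀ a, V a a = 1) (n : ℕ) :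
    ∫ z, (h (stationaryChain V n z) - gaussianMean V h) ^ 2 ∂(stationaryLaw V) =
      gaussianStd V h ^ 2 := by
  rw [gaussianStd, Real.sq_sqrt (variance_nonneg _ _), variance_eq_integral hh.aemeasurable]
  exact integral_comp_stationaryChain hV hVdiag ((hh.sub_const _).pow_const 2) n

-- The chain started at `0` is independent of the stationary initial state.
lemma integral_initial_mul_chain (hh : IsGaussianLipschitz κ γ V h) (hκ : 0 ≤ κ)
    (hlam0 : 0 < lam) (hlam : (V - lam • (1 : Matrix (Fin d) (Fin d) ℝ)).PosSemidef)
    (hVdiag : ∀ a, V a a = 1) (hγ0 : 0 < γ) (hγ1 : γ ≤ 1) (n : ℕ) :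
    ∫ z, (h z.2.1 - gaussianMean V h) * (h (chain V z.1 z.2.2 n) - gaussianMean V h)
      ∂(stationaryLaw V) = 0 := by
  have hV := (posDef_of_posSemidef_sub_smul_one hlam0 hlam).posSemidef
  have hX := (memLp_stationaryChain hh hV hVdiag 0).sub (memLp_const (gaussianMean V h))
  have hY := (memLp_chain hh hκ hlam0 hlam hVdiag hγ0 hγ1 n).sub (memLp_const (gaussianMean V h))
  refine (integral_prod _ (hX.integrable_mul hY)).trans ?_
  have hinner (i : ℕ → Fin d) :
      ∫ p : EuclideanSpace ℝ (Fin d) × (ℕ → ℝ), (h p.1 - gaussianMean V h) *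
        (h (chain V i p.2 n) - gaussianMean V h)
        ∂((multivariateGaussian 0 V).prod noiseLaw) = 0 := by
    rw [integral_prod_mul (fun x => h x - gaussianMean V h)
      (fun g => h (chain V i g n) - gaussianMean V h), hh.integral_sub_gaussianMean hV hVdiag,
      zero_mul]
  exact integral_eq_zero_of_ae (.of_forall hinner)

lemma abs_integral_mul_stationaryChain_le (hh : IsGaussianLipschitz κ γ V h) (hκ : 0 ≤ κ)
    (hlam0 : 0 < lam) (hlam : (V - lam • (1 : Matrix (Fin d) (Fin d) ℝ)).PosSemidef)
    (hVdiag : ∀ a, V a a = 1) (hγ0 : 0 < γ) (hγ1 : γ ≤ 1) (j m : ℕ) :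
    |∫ z, (h (stationaryChain V j z) - gaussianMean V h) *
        (h (stationaryChain V (j + m) z) - gaussianMean V h) ∂(stationaryLaw V)| ≤
      gaussianStd V h * (κ * d ^ γ * ((1 - lam / d) ^ (γ / 2)) ^ m) := by
  have hV := (posDef_of_posSemidef_sub_smul_one hlam0 hlam).posSemidef
  have hs := one_sub_div_nonneg hlam hVdiag
  have hB (k : ℕ) : MemLp (fun z => h (stationaryChain V k z) - gaussianMean V h) 2
      (stationaryLaw V) := (memLp_stationaryChain hh hV hVdiag k).sub (memLp_const _)
  have hA : MemLp (fun z => h (chain V z.1 z.2.2 m) - gaussianMean V h) 2 (stationaryLaw V) :=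
    (memLp_chain hh hκ hlam0 hlam hVdiag hγ0 hγ1 m).sub (memLp_const _)
  have hnorm : ‖(hB 0).toLp‖ = gaussianStd V h := by
    refine (sq_eq_sq₀ (norm_nonneg _) gaussianStd_nonneg).1 ?_
    rw [← real_inner_self_eq_norm_sq, inner_toLp]
    simpa only [← pow_two] using integral_sq_stationaryChain_sub_mean hh.measurable hV hVdiag 0
  have huncorrelated : inner ℝ (hB 0).toLp hA.toLp = 0 :=
    (inner_toLp (hB 0) hA).trans
      (integral_initial_mul_chain hh hκ hlam0 hlam hVdiag hγ0 hγ1 m)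
  rw [integral_mul_stationaryChain_add hV hVdiag (f := fun x => h x - gaussianMean V h)
    (hh.measurable.sub_const _)]
  calc |∫ z, (h z.2.1 - gaussianMean V h) * (h (stationaryChain V m z) - gaussianMean V h)
          ∂(stationaryLaw V)|
      = |inner ℝ (hB 0).toLp (hA.toLp - (hB m).toLp)| := by
        rw [inner_sub_right, huncorrelated, zero_sub, abs_neg, inner_toLp (hB 0) (hB m)]
        rfl
    _ ≤ ‖(hB 0).toLp‖ * ‖hA.toLp - (hB m).toLp‖ := abs_real_inner_le_norm _ _
    _ ≤ gaussianStd V h * (κ * d ^ γ * ((1 - lam / d) ^ (γ / 2)) ^ m) := by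
        rw [hnorm]
        refine mul_le_mul_of_nonneg_left (norm_toLp_sub_le hA (hB m) (by positivity) ?_)
          gaussianStd_nonneg
        simpa only [sub_sub_sub_cancel_right] using
          eLpNorm_chain_sub_stationaryChain_le hh hκ hlam0 hlam hVdiag hγ0 hγ1 m

end StationaryCovariances

section ChainInput

variable {Ω : Type*} [MeasurableSpace Ω] {P : Measure Ω} {d : ℕ} {V : Matrix (Fin d) (Fin d) ℝ}
  {h : EuclideanSpace ℝ (Fin d) → ℝ} {i : ℕ → Ω → Fin d} {g : ℕ → Ω → ℝ}

lemma IsChainInput.map_eq [IsProbabilityMeasure P] (hig : IsChainInput P i g) :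
    P.map (fun ω => (fun n => i n ω, fun n => g n ω)) = (indexLaw d).prod noiseLaw := by
  have hi : Measurable fun ω n => i n ω := measurable_pi_lambda _ hig.measurable_index
  have hg : Measurable fun ω n => g n ω := measurable_pi_lambda _ hig.measurable_noise
  rw [(indepFun_iff_map_prod_eq_prod_map_map hi.aemeasurable hg.aemeasurable).1 hig.indepFun.symm,
    hig.iIndepFun_index.map_fun_eq_infinitePi_map hig.measurable_index,
    hig.iIndepFun_noise.map_fun_eq_infinitePi_map hig.measurable_noise]
  simp only [hig.law_index, hig.law_noise, indexLaw, noiseLaw]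

lemma IsChainInput.identDistrib [IsProbabilityMeasure P] [NeZero d] (hig : IsChainInput P i g) :
    IdentDistrib (fun ω => (fun n => i n ω, fun n => g n ω)) (fun z => (z.1, z.2.2)) P
      (stationaryLaw V) where
  aemeasurable_fst := ((measurable_pi_lambda _ hig.measurable_index).prodMk
    (measurable_pi_lambda _ hig.measurable_noise)).aemeasurable
  aemeasurable_snd := by fun_prop
  map_eq := by
    rw [hig.map_eq]
    exact ((MeasurePreserving.id _).prod measurePreserving_snd).map_eq.symm

lemma measurable_burnInEstimator (hh : Measurable h) (n : ℕ) :
    Measurable fun u : (ℕ → Fin d) × (ℕ → ℝ) => burnInEstimator V h n u.1 u.2 :=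
  (Finset.measurable_fun_sum _ fun j _ => hh.comp (measurable_chain V j)).div_const _

lemma IsChainInput.identDistrib_burnInEstimator [IsProbabilityMeasure P] [NeZero d]
    (hig : IsChainInput P i g) (hh : Measurable h) (n : ℕ) :
    IdentDistrib (fun ω => burnInEstimator V h n (fun k => i k ω) (fun k => g k ω))
      (fun z => burnInEstimator V h n z.1 z.2.2) P (stationaryLaw V) :=
  hig.identDistrib.comp (measurable_burnInEstimator hh n)

end ChainInput

section Constants

variable {t p : ℝ}

lemma mul_le_one_sub_rpow_one_sub (ht : t ≤ 1) (hp0 : 0 ≤ p) (hp1 : p ≤ 1) :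
    p * t ≤ 1 - (1 - t) ^ p := by
  have hbernoulli := rpow_one_add_le_one_add_mul_self (neg_le_neg ht) hp0 hp1
  rw [← sub_eq_add_neg] at hbernoulli
  linarith

lemma rpow_one_sub_pow_le_exp (ht : t ≤ 1) (hp : 0 ≤ p) (m : ℕ) :
    ((1 - t) ^ p) ^ m ≤ Real.exp (-(p * t * m)) := by
  calc ((1 - t) ^ p) ^ m ≤ (Real.exp (-t) ^ p) ^ m := by
        gcongr
        exact Real.one_sub_le_exp_neg t
    _ = Real.exp (-(p * t * m)) := by
        rw [← Real.exp_mul, ← Real.exp_nat_mul]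
        ring_nf

/- With `ρ = S / L`, the tail is at most `S ρ / c`, and `ρ ≤ (5/2) (1 - ρ) ≤ (5/2) log (1 / ρ)`
because `ρ ≤ 5/7`. -/
lemma geometric_tail_le {K L S c r : ℝ} {δ : ℕ} (hr : 0 ≤ r) (hc : 0 < c) (hcr : c ≤ 1 - r)
    (hrδ : r ^ δ ≤ Real.exp (-(c * δ))) (hKL : K ≤ L) (hS : 0 < S) (hSL : 7 * S ≤ 5 * L)
    (hδ : 2 * Real.log (L / S) ≤ c * δ) :
    K * r ^ δ / (1 - r) ≤ 5 / 4 * (S * δ) := by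
  have hL : 0 < L := by linarith
  set ρ : ℝ := S / L with hρ
  have hρ0 : 0 < ρ := div_pos hS hL
  have hρ1 : ρ ≤ 5 / 7 := by rw [hρ, div_le_div_iff₀ hL (by norm_num)]; linarith
  have hlog : Real.log (L / S) = -Real.log ρ := by rw [← Real.log_inv, hρ, inv_div]
  have hrate : r ^ δ ≤ ρ ^ 2 := by
    refine hrδ.trans ?_
    rw [← Real.exp_log (pow_pos hρ0 2), Real.log_pow, Nat.cast_ofNat]
    exact Real.exp_le_exp.2 (by linarith)
  have hρδ : ρ ≤ 5 / 4 * (c * δ) := by linarith [Real.log_le_sub_one_of_pos hρ0]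
  calc K * r ^ δ / (1 - r) ≤ L * ρ ^ 2 / c := by gcongr
    _ = S * ρ / c := by rw [hρ]; field_simp
    _ ≤ S * (5 / 4 * (c * δ)) / c := by gcongr
    _ = 5 / 4 * (S * δ) := by field_simp

lemma two_mul_sq_add_le {S T δ k : ℝ} (hS : 0 ≤ S) (hT : 0 ≤ T) (hδ : 0 ≤ δ) (hδk : δ ≤ k)
    (hTS : T ≤ 5 / 4 * (S * δ)) :
    2 * (T ^ 2 + 2 * k * (δ * S ^ 2 + S * T)) ≤ 25 / 2 * (δ * S ^ 2 * k) := by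
  have hk : 0 ≤ k := hδ.trans hδk
  calc 2 * (T ^ 2 + 2 * k * (δ * S ^ 2 + S * T))
      ≤ 2 * ((5 / 4 * (S * δ)) ^ 2 + 2 * k * (δ * S ^ 2 + S * (5 / 4 * (S * δ)))) := by gcongr
    _ = 2 * (δ * S ^ 2) * (25 / 16 * δ + 9 / 2 * k) := by ring
    _ ≤ 2 * (δ * S ^ 2) * (25 / 16 * k + 9 / 2 * k) := by gcongr
    _ ≤ 25 / 2 * (δ * S ^ 2 * k) := by linarith [show 0 ≤ δ * S ^ 2 * k by positivity]

end Constants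

section Estimator

variable {d : ℕ} {V : Matrix (Fin d) (Fin d) ℝ} {lam κ γ : ℝ}
  {h : EuclideanSpace ℝ (Fin d) → ℝ}

lemma burnInEstimator_sub {k : ℕ} (hk : 0 < k) (i : ℕ → Fin d) (g : ℕ → ℝ) (c : ℝ) :
    burnInEstimator V h (2 * k) i g - c =
      (∑ j ∈ Finset.Ico k (2 * k), (h (chain V i g j) - c)) / k := by
  rw [burnInEstimator, Nat.mul_div_cancel_left k two_pos, Finset.sum_sub_distrib,
    Finset.sum_const, Nat.card_Ico, show 2 * k - k = k by omega, nsmul_eq_mul]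
  push_cast
  field_simp

lemma IsGaussianLipschitz.seven_mul_gaussianStd_le (hh : IsGaussianLipschitz κ γ V h)
    (hκ : 0 ≤ κ) (hV : V.PosSemidef) (hVdiag : ∀ a, V a a = 1) (hγ1 : γ ≤ 1) (hd : 2 ≤ d) :
    7 * gaussianStd V h ≤ 5 * (κ * d) := by
  have hd' : (2 : ℝ) ≤ d := by exact_mod_cast hd
  have hdγ : (d : ℝ) ^ γ ≤ d := Real.rpow_le_self_of_one_le (by linarith) hγ1
  refine le_of_sq_le_sq ?_ (by positivity)
  calc (7 * gaussianStd V h) ^ 2 ≤ 49 * (κ ^ 2 * d) := by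
        rw [mul_pow]
        norm_num
        exact (hh.gaussianStd_sq_le hV hVdiag).trans (by gcongr)
    _ ≤ 25 * (κ ^ 2 * (d * d)) := by
        nlinarith [mul_le_mul_of_nonneg_left hd' (show 0 ≤ κ ^ 2 * d by positivity),
          show 0 ≤ κ ^ 2 * d by positivity]
    _ = (5 * (κ * d)) ^ 2 := by ring

variable [NeZero d]

lemma memLp_burnInEstimator (hh : IsGaussianLipschitz κ γ V h) (hκ : 0 ≤ κ)
    (hlam0 : 0 < lam) (hlam : (V - lam • (1 : Matrix (Fin d) (Fin d) ℝ)).PosSemidef)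
    (hVdiag : ∀ a, V a a = 1) (hγ0 : 0 < γ) (hγ1 : γ ≤ 1) (n : ℕ) :
    MemLp (fun z => burnInEstimator V h n z.1 z.2.2) 2 (stationaryLaw V) := by
  simp only [burnInEstimator, div_eq_inv_mul]
  exact (memLp_finsetSum _ fun j _ =>
    memLp_chain hh hκ hlam0 hlam hVdiag hγ0 hγ1 j).const_mul _

lemma abs_integral_burnInEstimator_sub_le (hh : IsGaussianLipschitz κ γ V h) (hκ : 0 ≤ κ)
    (hlam0 : 0 < lam) (hlam : (V - lam • (1 : Matrix (Fin d) (Fin d) ℝ)).PosSemidef)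
    (hVdiag : ∀ a, V a a = 1) (hγ0 : 0 < γ) (hγ1 : γ ≤ 1) {k : ℕ} (hk : 0 < k) :
    |∫ z, (burnInEstimator V h (2 * k) z.1 z.2.2 - gaussianMean V h) ∂(stationaryLaw V)| ≤
      κ * d ^ γ * Real.exp (-(γ / 2 * (lam / d) * k)) / (γ / 2 * (lam / d)) / k := by
  have hV := (posDef_of_posSemidef_sub_smul_one hlam0 hlam).posSemidef
  have hd : (0 : ℝ) < d := by exact_mod_cast NeZero.pos d
  have hs := one_sub_div_nonneg hlam hVdiag
  have hc : 0 < γ / 2 * (lam / d) := by positivity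
  have hcr : γ / 2 * (lam / d) ≤ 1 - (1 - lam / d) ^ (γ / 2) :=
    mul_le_one_sub_rpow_one_sub (sub_nonneg.1 hs) (by linarith) (by linarith)
  simp only [burnInEstimator_sub hk]
  rw [integral_div, abs_div, Nat.abs_cast]
  gcongr
  refine (abs_integral_sum_Ico_le_of_eLpNorm_sub_le
    (A := fun j z => h (chain V z.1 z.2.2 j) - gaussianMean V h)
    (B := fun j z => h (stationaryChain V j z) - gaussianMean V h)
    (K := κ * d ^ γ) (r := (1 - lam / d) ^ (γ / 2))
    (fun j => (memLp_chain hh hκ hlam0 hlam hVdiag hγ0 hγ1 j).sub (memLp_const _))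
    (fun j => (memLp_stationaryChain hh hV hVdiag j).sub (memLp_const _))
    (by positivity) (by positivity) (by linarith) (fun j => ?_)
    (integral_stationaryChain_sub_mean hh hV hVdiag) k (2 * k)).trans ?_
  · simpa only [sub_sub_sub_cancel_right] using
      eLpNorm_chain_sub_stationaryChain_le hh hκ hlam0 hlam hVdiag hγ0 hγ1 j
  · gcongr
    exact rpow_one_sub_pow_le_exp (sub_nonneg.1 hs) (by linarith) k

lemma integral_sq_burnInEstimator_sub_le (hh : IsGaussianLipschitz κ γ V h) (hκ : 0 ≤ κ)
    (hlam0 : 0 < lam) (hlam : (V - lam • (1 : Matrix (Fin d) (Fin d) ℝ)).PosSemidef)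
    (hVdiag : ∀ a, V a a = 1) (hγ0 : 0 < γ) (hγ1 : γ ≤ 1) (hd : 2 ≤ d)
    (hS : 0 < gaussianStd V h) {δ k : ℕ} (hk : 0 < k) (hδk : δ ≤ k)
    (hδ : 4 * (lam * γ)⁻¹ * d * Real.log (κ * d / gaussianStd V h) ≤ δ) :
    ∫ z, (burnInEstimator V h (2 * k) z.1 z.2.2 - gaussianMean V h) ^ 2 ∂(stationaryLaw V) ≤
      25 / 2 * (δ * gaussianStd V h ^ 2 / k) := by
  have hV := (posDef_of_posSemidef_sub_smul_one hlam0 hlam).posSemidef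
  have hs := one_sub_div_nonneg hlam hVdiag
  have hc : 0 < γ / 2 * (lam / d) := by positivity
  have hcr : γ / 2 * (lam / d) ≤ 1 - (1 - lam / d) ^ (γ / 2) :=
    mul_le_one_sub_rpow_one_sub (sub_nonneg.1 hs) (by linarith) (by linarith)
  have hd1 : (1 : ℝ) ≤ d := by exact_mod_cast one_le_two.trans hd
  have hlog : 2 * Real.log (κ * d / gaussianStd V h) ≤ γ / 2 * (lam / d) * δ := by
    refine le_of_eq_of_le ?_ (mul_le_mul_of_nonneg_left hδ hc.le)
    field_simp
    ring
  have htail := geometric_tail_le (by positivity) hc hcr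
    (rpow_one_sub_pow_le_exp (sub_nonneg.1 hs) (by linarith) δ)
    (mul_le_mul_of_nonneg_left (Real.rpow_le_self_of_one_le hd1 hγ1) hκ) hS
    (hh.seven_mul_gaussianStd_le hκ hV hVdiag hγ1 hd) hlog
  have hsum := integral_sq_sum_Ico_le_of_eLpNorm_sub_le
    (A := fun j z => h (chain V z.1 z.2.2 j) - gaussianMean V h)
    (B := fun j z => h (stationaryChain V j z) - gaussianMean V h)
    (K := κ * d ^ γ) (r := (1 - lam / d) ^ (γ / 2))
    (fun j => (memLp_chain hh hκ hlam0 hlam hVdiag hγ0 hγ1 j).sub (memLp_const _))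
    (fun j => (memLp_stationaryChain hh hV hVdiag j).sub (memLp_const _))
    (by positivity) hS.le (by positivity) (by linarith)
    (fun j => by simpa only [sub_sub_sub_cancel_right] using
      eLpNorm_chain_sub_stationaryChain_le hh hκ hlam0 hlam hVdiag hγ0 hγ1 j)
    (fun j => (integral_sq_stationaryChain_sub_mean hh.measurable hV hVdiag j).le)
    (abs_integral_mul_stationaryChain_le hh hκ hlam0 hlam hVdiag hγ0 hγ1) hδk
  simp only [burnInEstimator_sub hk, div_pow]
  rw [integral_div, div_le_iff₀ (by positivity)]
  refine (hsum.trans (two_mul_sq_add_le hS.le ?_ (by positivity) (by exact_mod_cast hδk)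
    htail)).trans_eq (by field_simp)
  exact div_nonneg (by positivity) (hc.le.trans hcr)

end Estimator

theorem mainTheorem4_general {d : ℕ} (hd : 2 ≤ d)
    (V : Matrix (Fin d) (Fin d) ℝ) (hVdiag : ∀ a, V a a = 1)
    (lam : ℝ) (hlam0 : 0 < lam) (hlam : (V - lam • (1 : Matrix (Fin d) (Fin d) ℝ)).PosSemidef)
    (κ γ : ℝ) (hκ : 0 ≤ κ) (hγ0 : 0 < γ) (hγ1 : γ ≤ 1)
    (h : EuclideanSpace ℝ (Fin d) → ℝ) (hh : IsGaussianLipschitz κ γ V h)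
    (κ' : ℝ) (hκ' : κ' = 2 * κ * (d : ℝ) ^ (1 + γ) / (lam * γ))
    (δ : ℤ) (hδ : δ = ⌈4 * (lam * γ)⁻¹ * d * Real.log (κ * d / gaussianStd V h)⌉)
    {Ω : Type*} [MeasurableSpace Ω] (P : Measure Ω) [IsProbabilityMeasure P]
    (i : ℕ → Ω → Fin d) (g : ℕ → Ω → ℝ) (hig : IsChainInput P i g)
    (n : ℕ) (hn0 : 0 < n) (hn : Even n) :
    MemLp h 2 (multivariateGaussian 0 V) ∧
    MemLp (fun ω => burnInEstimator V h n (fun k => i k ω) (fun k => g k ω)) 2 P ∧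
    |∫ ω, (burnInEstimator V h n (fun k => i k ω) (fun k => g k ω) - gaussianMean V h) ∂P|
      ≤ 2 * κ' * (Real.exp (-(lam * γ * n / (4 * d))) / n) ∧
    (0 < gaussianStd V h → 2 * δ < (n : ℤ) →
      ∫ ω, (burnInEstimator V h n (fun k => i k ω) (fun k => g k ω) - gaussianMean V h) ^ 2 ∂P
        ≤ 25 * (δ * gaussianStd V h ^ 2 / n)) := by
  obtain ⟨k, rfl⟩ := hn.two_dvd
  have : NeZero d := ⟨by omega⟩
  have hd0 : (0 : ℝ) < d := by exact_mod_cast NeZero.pos d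
  have hk : 0 < k := by omega
  have hV := (posDef_of_posSemidef_sub_smul_one hlam0 hlam).posSemidef
  have hlaw := hig.identDistrib_burnInEstimator (V := V) hh.measurable (2 * k)
  have hlaw_sub := hlaw.comp (measurable_id.sub_const (gaussianMean V h))
  refine ⟨hh.memLp hV hVdiag,
    hlaw.memLp_iff.2 (memLp_burnInEstimator hh hκ hlam0 hlam hVdiag hγ0 hγ1 _), ?_,
    fun hS hδk => ?_⟩
  · refine (congrArg _ hlaw_sub.integral_eq).trans_le
      ((abs_integral_burnInEstimator_sub_le hh hκ hlam0 hlam hVdiag hγ0 hγ1 hk).trans_eq ?_)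
    rw [hκ', Real.rpow_add hd0, Real.rpow_one]
    push_cast
    field_simp
    ring_nf
  · refine (hlaw_sub.comp (measurable_id.pow_const 2)).integral_eq.trans_le ?_
    have hlog : 0 ≤ Real.log (κ * d / gaussianStd V h) := Real.log_nonneg
      ((one_le_div hS).2 (by linarith [hh.seven_mul_gaussianStd_le hκ hV hVdiag hγ1 hd]))
    lift δ to ℕ using hδ ▸ Int.ceil_nonneg (by positivity)
    refine (integral_sq_burnInEstimator_sub_le hh hκ hlam0 hlam hVdiag hγ0 hγ1 hd hS hk (δ := δ)
      (by omega) (by exact_mod_cast Int.ceil_le.1 hδ.ge)).trans_eq ?_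
    push_cast
    field_simp

theorem mainTheorem4 {d : ℕ} (hd : 3 ≤ d)
    (V : Matrix (Fin d) (Fin d) ℝ) (hV : V.PosDef) (hVdiag : ∀ a, V a a = 1)
    (lam : ℝ) (hlam : IsLeast {μ : ℝ | Module.End.HasEigenvalue (Matrix.toLin' V) μ} lam)
    (κ γ : ℝ) (hκ : 0 < κ) (hγ0 : 0 < γ) (hγ1 : γ ≤ 1)
    (h : EuclideanSpace ℝ (Fin d) → ℝ) (hh : IsGaussianLipschitz κ γ V h)
    (κ' : ℝ) (hκ' : κ' = 2 * κ * (d : ℝ) ^ (1 + γ) / (lam * γ))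
    (δ : ℤ) (hδ : δ = ⌈4 * (lam * γ)⁻¹ * d * Real.log (κ * d / gaussianStd V h)⌉)
    {Ω : Type*} [MeasurableSpace Ω] (P : Measure Ω) [IsProbabilityMeasure P]
    (i : ℕ → Ω → Fin d) (g : ℕ → Ω → ℝ) (hig : IsChainInput P i g)
    (n : ℕ) (hn0 : 0 < n) (hn : Even n) :
    MemLp h 2 (multivariateGaussian 0 V) ∧
    MemLp (fun ω => burnInEstimator V h n (fun k => i k ω) (fun k => g k ω)) 2 P ∧
    |∫ ω, (burnInEstimator V h n (fun k => i k ω) (fun k => g k ω) - gaussianMean V h) ∂P|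
      ≤ 2 * κ' * (Real.exp (-(lam * γ * n / (4 * d))) / n) ∧
    (0 < gaussianStd V h → 2 * δ < (n : ℤ) →
      ∫ ω, (burnInEstimator V h n (fun k => i k ω) (fun k => g k ω) - gaussianMean V h) ^ 2 ∂P
        ≤ 34 * (δ * gaussianStd V h ^ 2 / n)) := by
  obtain ⟨hmemLp, hestimator, hbias, hmse⟩ := mainTheorem4_general (by omega) V hVdiag lam
    (pos_of_posDef_of_hasEigenvalue hV hlam.1)
    (posSemidef_sub_smul_one_of_isLeast_hasEigenvalue hV.isHermitian hlam) κ γ hκ.le hγ0 hγ1 h hh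
    κ' hκ' δ hδ P i g hig n hn0 hn
  refine ⟨hmemLp, hestimator, hbias, fun hS hδn => (hmse hS hδn).trans ?_⟩
  have hnonneg := (integral_nonneg fun ω => sq_nonneg _).trans (hmse hS hδn)
  linarith
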